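/- Let $K$ be a commutative ring, let $\Lambda$ be the ring of symmetric functions over $K$ (symmetric formal power series of bounded degree in $x_1,x_2,\dots$ with coefficients in $K$), and let $\widehat\Lambda$ be its completion, the ring of all symmetric formal power series. Let $(\,,)\colon\widehat\Lambda\times\Lambda\to K$ be the Hall inner product, the pairing for which the Schur functions are orthonormal: if $F=\sum_\lambda A_\lambda s_\lambda\in\widehat\Lambda$ (possibly an infinite sum) and $f=\sum_\lambda B_\lambda s_\lambda\in\Lambda$ (a finite sum), then $(F,f)=\sum_\lambda A_\lambda B_\lambda$. Let $E(-1)=\sum_{i\ge 0}(-1)^i e_i\in\widehat\Lambda$, where $e_i$ is the $i$-th elementary symmetric function. For partitions $\mu\subset\lambda$, the dual stable Grothendieck polynomial is $g_{\lambda/\mu}=\sum_T x^T$, summed over the reverse plane partitions $T$ of shape $\lambda/\mu$ (fillings of the cells of $\lambda/\mu$ by positive integers that weakly increase along rows and columns), where $x^T=\prod_i x_i^{T(i)}$ and $T(i)$ is the number of columns of $T$ that contain $i$. Write $g_\lambda=g_{\lambda/\emptyset}$, and let $|\lambda/\mu|$ be the number of cells of $\lambda/\mu$. The skew shape $\lambda/\mu$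 is called a rook strip if every cell of $\lambda/\mu$ is a removable corner of $\lambda$. Then $g_{\lambda/\mu}\in\Lambda$ for all $\mu\subset\lambda$, and the following hold. 1. The map $(E(-1),-)\colon\Lambda\to K$ is a $K$-algebra homomorphism, and for all $\mu\subset\lambda$ $$(E(-1),g_{\lambda/\mu})=\begin{cases}(-1)^{|\lambda/\mu|}&\text{if }\lambda/\mu\text{ is a rook strip},\\0&\text{otherwise.}\end{cases}$$ In particular $(E(-1),g_\emptyset)=1$, $(E(-1),g_{(1)})=-1$, and $(E(-1),g_\lambda)=0$ whenever $|\lambda|>1$. 2. These values are those of the Möbius function $\mu_{\mathcal P}$ of Young's lattice (partitions ordered by inclusion): for all $\mu\subset\lambda$, the integer $\mu_{\mathcal P}(\mu,\lambda)$ is $(-1)^{|\lambda/\mu|}$ if $\lambda/\mu$ is a rook strip and $0$ otherwise, and $(E(-1),g_{\lambda/\mu})$ is the image of $\mu_{\mathcal P}(\mu,\lambda)$ in $K$. 3. There is exactly one $K$-linear map $I\colon\Lambda\to\Lambda$ with $I(g_\lambda)=\sum_{\mu\subset\lambda}g_\mu$ for all partitions $\lambda$; it is a $K$-algebra automorphism,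 and for all $\mu\subset\lambda$ $$I^{-1}(g_{\lambda/\mu})=\sum_{\substack{\mu\subset\nu\subset\lambda\\ \lambda/\nu\text{ rook strip}}}(-1)^{|\lambda/\nu|}g_{\nu/\mu}=\sum_{\substack{\mu\subset\nu\subset\lambda\\ \nu/\mu\text{ rook strip}}}(-1)^{|\nu/\mu|}g_{\lambda/\nu}.$$ -/

import Mathlib

/-! Symmetric functions in the variables `x 0, x 1, x 2, …` over a commutative ring `K`, realised
inside the ring of formal power series `MvPowerSeries ℕ K`. Tableau entries are natural numbers,
the entry `k` contributing the variable `x k`. -/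

noncomputable section

namespace SymFun

open MvPowerSeries

/-- The ring of symmetric formal power series (of possibly unbounded degree). -/
def Completed (K : Type*) [CommRing K] : Subalgebra K (MvPowerSeries ℕ K) where
  carrier := {F | ∀ σ : Equiv.Perm ℕ, renameEquiv (R := K) σ F = F}
  mul_mem' hF hG σ := by rw [map_mul, hF σ, hG σ]
  add_mem' hF hG σ := by rw [map_add, hF σ, hG σ]
  algebraMap_mem' r σ := (renameEquiv (R := K) σ).commutes r

/-- Symmetry in terms of coefficients. -/
theorem mem_completed_iff {K : Type*} [CommRing K] (F : MvPowerSeries ℕ K) :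
    F ∈ Completed K ↔
      ∀ (σ : Equiv.Perm ℕ) (d : ℕ →₀ ℕ), coeff (d.mapDomain σ) F = coeff d F := by
  have key : ∀ (σ : Equiv.Perm ℕ) (d : ℕ →₀ ℕ),
      coeff (d.mapDomain σ) (renameEquiv (R := K) σ F) = coeff d F := by
    intro σ d
    have h := coeff_embDomain_rename (R := K) (e := σ.toEmbedding) F d
    rw [Finsupp.embDomain_eq_mapDomain] at h
    exact h
  constructor
  · intro h σ d
    rw [← key σ d, h σ]
  · intro h σ
    ext d
    have h2 := key σ (d.mapDomain σ.symm)
    have h3 := h σ (d.mapDomain σ.symm)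
    have h4 : (d.mapDomain σ.symm).mapDomain σ = d := by
      rw [← Finsupp.mapDomain_comp]
      simp
    rw [h4] at h2 h3
    rw [h2, h3]

/-- The ring `Λ` of symmetric functions: symmetric formal power series of bounded degree. -/
def SymmFn (K : Type*) [CommRing K] : Subalgebra K (MvPowerSeries ℕ K) where
  carrier := {f | f ∈ Completed K ∧ ∃ N : ℕ, ∀ d : ℕ →₀ ℕ, N < d.degree → coeff d f = 0}
  mul_mem' := by
    classical
    rintro f g ⟨hf, N, hN⟩ ⟨hg, M, hM⟩
    refine ⟨mul_mem hf hg, N + M, fun d hd => ?_⟩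
    rw [coeff_mul]
    refine Finset.sum_eq_zero fun p hp => ?_
    have hp' : p.1 + p.2 = d := by simpa using hp
    rw [← hp', map_add] at hd
    rcases Nat.lt_or_ge N p.1.degree with h | h
    · rw [hN _ h, zero_mul]
    · rw [hM p.2 (by omega), mul_zero]
  add_mem' := by
    rintro f g ⟨hf, N, hN⟩ ⟨hg, M, hM⟩
    refine ⟨add_mem hf hg, max N M, fun d hd => ?_⟩
    rw [map_add, hN d (by omega), hM d (by omega), add_zero]
  algebraMap_mem' r := by
    classical
    refine ⟨(Completed K).algebraMap_mem r, 0, fun d hd => ?_⟩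
    rw [MvPowerSeries.algebraMap_apply, coeff_C, if_neg]
    rintro rfl
    simp at hd

/-! ### Schur functions and the Hall inner product -/

/-- The content of a semistandard tableau: the exponent vector of its monomial. -/
def content {lam : YoungDiagram} (T : SemistandardYoungTableau lam) : ℕ →₀ ℕ :=
  ∑ c ∈ lam.cells, Finsupp.single (T c.1 c.2) 1

/-- The Schur function `s_lam`, the generating function of semistandard tableaux: the coefficient
of `x ^ d` is the number of semistandard tableaux of shape `lam` and content `d`. -/
def schur (K : Type*) [CommRing K] (lam : YoungDiagram) : MvPowerSeries ℕ K :=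
  fun d => (Nat.card {T : SemistandardYoungTableau lam // content T = d} : K)

/-- `F = ∑ A lam • s_lam` as a formal, possibly infinite, linear combination of Schur functions
(for each monomial only the finitely many `lam` of the same size contribute). -/
def IsSchurExpansion {K : Type*} [CommRing K] (F : MvPowerSeries ℕ K) (A : YoungDiagram → K) :
    Prop :=
  ∀ d : ℕ →₀ ℕ, coeff d F = ∑ᶠ lam : YoungDiagram, A lam * coeff d (schur K lam)

open Classical in
/-- The coefficients of a symmetric formal power series in its expansion into Schur functions
(such an expansion exists and is unique). -/
def schurCoeff {K : Type*} [CommRing K] (F : Completed K) : YoungDiagram → K :=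
  if h : ∃ A, IsSchurExpansion (F : MvPowerSeries ℕ K) A then h.choose else 0

/-- The Hall inner product, for which the Schur functions are orthonormal, extended to pairs of
a symmetric formal power series and a symmetric function. The sum is finite since the second
argument is a finite combination of Schur functions. -/
def hall {K : Type*} [CommRing K] (F : Completed K) (f : SymmFn K) : K :=
  ∑ᶠ lam : YoungDiagram, schurCoeff F lam * schurCoeff ⟨f, f.2.1⟩ lam

/-! ### Elementary symmetric functions -/

open Classical in
/-- The elementary symmetric function `e_i`: the sum of all squarefree monomials of degree `i`. -/
def elem (K : Type*) [CommRing K] (i : ℕ) : MvPowerSeries ℕ K :=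
  fun d => if d.degree = i ∧ ∀ k, d k ≤ 1 then 1 else 0

/-- The series `∑ i, t ^ i • e_i`. -/
def elemSeries {K : Type*} [CommRing K] (t : K) : MvPowerSeries ℕ K :=
  fun d => ∑ᶠ i : ℕ, t ^ i * coeff d (elem K i)

open Classical in
theorem elemSeries_mem {K : Type*} [CommRing K] (t : K) : elemSeries t ∈ Completed K := by
  rw [mem_completed_iff]
  intro σ d
  have h1 : (d.mapDomain σ).degree = d.degree := by
    rw [Finsupp.degree_mapDomain]
  have h2 : (∀ k, (d.mapDomain σ) k ≤ 1) ↔ ∀ k, d k ≤ 1 := by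
    constructor
    · intro h k
      have := h (σ k)
      rwa [Finsupp.mapDomain_apply σ.injective] at this
    · intro h k
      rw [← σ.apply_symm_apply k, Finsupp.mapDomain_apply σ.injective]
      exact h _
  have h3 : ∀ i, coeff (d.mapDomain σ) (elem K i) = coeff d (elem K i) := by
    intro i
    change (if (d.mapDomain σ).degree = i ∧ ∀ k, (d.mapDomain σ) k ≤ 1 then (1 : K) else 0) =
      if d.degree = i ∧ ∀ k, d k ≤ 1 then 1 else 0
    simp only [h1, h2]
  change ∑ᶠ i : ℕ, t ^ i * coeff (d.mapDomain σ) (elem K i) =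
    ∑ᶠ i : ℕ, t ^ i * coeff d (elem K i)
  simp only [h3]

/-- `E(t) = ∑ i, t ^ i • e_i` as a symmetric formal power series. -/
def E {K : Type*} [CommRing K] (t : K) : Completed K := ⟨elemSeries t, elemSeries_mem t⟩

/-! ### Skew shapes, reverse plane partitions, dual stable Grothendieck polynomials -/

/-- The set of cells of the skew shape `lam / mu` (used when `mu ≤ lam`). -/
def skewCells (lam mu : YoungDiagram) : Finset (ℕ × ℕ) := lam.cells \ mu.cells

/-- A reverse plane partition of shape `lam / mu`: a filling of the cells whose rows and columns
are weakly increasing. As for `SemistandardYoungTableau`, it is a function on all of `ℕ × ℕ` that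
vanishes outside the shape. -/
@[ext]
structure ReversePlanePartition (lam mu : YoungDiagram) where
  entry : ℕ → ℕ → ℕ
  row_weak : ∀ {i j₁ j₂ : ℕ}, j₁ < j₂ → (i, j₁) ∈ skewCells lam mu → (i, j₂) ∈ skewCells lam mu →
    entry i j₁ ≤ entry i j₂
  col_weak : ∀ {i₁ i₂ j : ℕ}, i₁ < i₂ → (i₁, j) ∈ skewCells lam mu → (i₂, j) ∈ skewCells lam mu →
    entry i₁ j ≤ entry i₂ j
  zeros : ∀ {i j : ℕ}, (i, j) ∉ skewCells lam mu → entry i j = 0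

/-- The weight of a reverse plane partition `T`: its value at `k` is the number of columns of `T`
that contain the entry `k` (the sum runs over the distinct pairs of an entry and a column
containing it). -/
def ReversePlanePartition.weight {lam mu : YoungDiagram} (T : ReversePlanePartition lam mu) :
    ℕ →₀ ℕ :=
  ∑ p ∈ (skewCells lam mu).image (fun c => (T.entry c.1 c.2, c.2)), Finsupp.single p.1 1

/-- The dual stable Grothendieck polynomial `g_{lam/mu}`: the coefficient of `x ^ d` is the number
of reverse plane partitions of shape `lam / mu` and weight `d`. -/
def dualGrothendieck (K : Type*) [CommRing K] (lam mu : YoungDiagram) : MvPowerSeries ℕ K :=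
  fun d => (Nat.card {T : ReversePlanePartition lam mu // T.weight = d} : K)

/-- `lam / mu` is a rook strip: every cell of `lam / mu` is a removable corner of `lam`, that is,
neither the cell below it nor the cell to its right belongs to `lam`. -/
def IsRookStrip (lam mu : YoungDiagram) : Prop :=
  ∀ c ∈ skewCells lam mu, (c.1 + 1, c.2) ∉ lam ∧ (c.1, c.2 + 1) ∉ lam

/-! ### Young's lattice -/

/-- Intervals of Young's lattice (Young diagrams ordered by inclusion) are finite. -/
instance instLocallyFiniteOrderYoung : LocallyFiniteOrder YoungDiagram :=
  LocallyFiniteOrder.ofFiniteIcc fun a b => by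
    refine Set.Finite.of_finite_image (f := YoungDiagram.cells)
      ((b.cells.powerset.finite_toSet).subset ?_) ?_
    · rintro _ ⟨x, hx, rfl⟩
      exact Finset.mem_coe.2 (Finset.mem_powerset.2 (YoungDiagram.cells_subset_iff.2 hx.2))
    · intro x _ y _ h
      exact YoungDiagram.ext h

end SymFun

end

noncomputable section

namespace SymFun

open MvPowerSeries

/-! ### Peeling off the first column of a Young diagram -/

/-! A reverse plane partition of shape `lam / mu` is a chain of diagrams from `mu` to `lam`: the
cells with entry `k` form an arbitrary skew shape, which contributes to the exponent of `x k` its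
number of nonempty columns. Let `colOp K k` be the element of the incidence algebra of Young's
lattice that marks the skew shapes with exactly `k` nonempty columns. The coefficient of `x ^ d` in
`g_{lam/mu}` is then the `(mu, lam)` entry of the product of the operators `colOp K (d i)`. Symmetry
of `g_{lam/mu}` amounts to commutation of these operators (`colOp_comm`), which is the symmetry in
`x` and `y` of the sum of `x ^ numCols nu mu * y ^ numCols lam nu` over an interval
(`sum_Icc_symm`). That is proved by peeling off first columns.

The automorphism `I` is `f(x) ↦ f(1, x)`: adjoin a variable and set it equal to `1`. It is
multiplicative, and `I - 1` lowers degree, so it is bijective. On `g_{lam/mu}` the new variable adds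
one transfer operator, with all its exponents summed. Placed last, it gives the sum of the
`g_{nu/mu}`; placed first, which is allowed by commutation, the sum of the `g_{lam/nu}`. Both
formulas for the inverse of `I` follow by Möbius inversion, and the Möbius function is computed from
the alternating sum over sets of removable corners (`sum_rookStrip`, `mu_eq`).

The link with `E(-1)` is that `(E(-1), I f)` is the constant term of `f` (`hallLin_plusOne`): the
adjoint of `I` is multiplication by the sum of all complete homogeneous functions, whose inverse is
`E(-1)`. This is checked on Schur functions, where the branching rule leaves two cancelling columns.
So pairing with `E(-1)` is `I⁻¹` followed by the constant term, an algebra homomorphism. The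
constant term of `g_{nu/mu}` vanishes unless `nu = mu`, so the value on `g_{lam/mu}` is the Möbius
number.

The Schur expansions behind the Hall product come from unitriangularity at partition exponents.
Symmetry of `s_lam` is inherited from `g_lam`, whose top-degree component it is. -/

/-- The Young diagram obtained by deleting the first column. -/
def dropCol (nu : YoungDiagram) : YoungDiagram where
  cells := nu.cells.preimage (Prod.map id Nat.succ)
    (Function.Injective.prodMap Function.injective_id Nat.succ_injective).injOn
  isLowerSet := by
    rintro ⟨a, b⟩ ⟨c, d⟩ h hc
    rw [Finset.mem_coe, Finset.mem_preimage] at hc ⊢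
    exact nu.up_left_mem h.1 (Nat.succ_le_succ h.2) hc

@[simp]
theorem mem_dropCol {nu : YoungDiagram} {i j : ℕ} : (i, j) ∈ dropCol nu ↔ (i, j + 1) ∈ nu := by
  rw [← YoungDiagram.mem_cells, ← YoungDiagram.mem_cells, dropCol, Finset.mem_preimage]
  rfl

/-- The Young diagram with first column of length `k` and the columns of `nu` to its right. -/
def consCol (k : ℕ) (nu : YoungDiagram) (h : nu.colLen 0 ≤ k) : YoungDiagram where
  cells := (Finset.range k).image (fun i => (i, 0)) ∪ nu.cells.image (fun c => (c.1, c.2 + 1))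
  isLowerSet := by
    rintro ⟨a, b⟩ ⟨c, d⟩ hle hc
    obtain ⟨h1, h2⟩ : c ≤ a ∧ d ≤ b := hle
    simp only [Finset.coe_union, Set.mem_union, Finset.mem_coe, Finset.mem_image, Finset.mem_range,
      Prod.mk.injEq, YoungDiagram.mem_cells, Prod.exists] at hc ⊢
    rcases hc with ⟨i, hi, rfl, rfl⟩ | ⟨i, j, hij, rfl, rfl⟩
    · exact Or.inl ⟨c, by omega, rfl, by omega⟩
    · rcases d with _ | d
      · have h3 : (i, 0) ∈ nu := nu.up_left_mem le_rfl (Nat.zero_le _) hij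
        rw [YoungDiagram.mem_iff_lt_colLen] at h3
        exact Or.inl ⟨c, by omega, rfl, rfl⟩
      · exact Or.inr ⟨c, d, nu.up_left_mem h1 (by omega) hij, rfl, rfl⟩

@[simp]
theorem zero_mem_consCol {k : ℕ} {nu : YoungDiagram} {h : nu.colLen 0 ≤ k} {i : ℕ} :
    (i, 0) ∈ consCol k nu h ↔ i < k := by
  rw [← YoungDiagram.mem_cells]
  simp [consCol]

@[simp]
theorem succ_mem_consCol {k : ℕ} {nu : YoungDiagram} {h : nu.colLen 0 ≤ k} {i j : ℕ} :
    (i, j + 1) ∈ consCol k nu h ↔ (i, j) ∈ nu := by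
  rw [← YoungDiagram.mem_cells]
  simp [consCol]

theorem colLen_eq_of_forall {nu : YoungDiagram} {j k : ℕ} (h : ∀ i, (i, j) ∈ nu ↔ i < k) :
    nu.colLen j = k := by
  refine le_antisymm (le_of_not_gt fun h1 => ?_) (le_of_not_gt fun h1 => ?_)
  · exact lt_irrefl _ ((h k).1 (YoungDiagram.mem_iff_lt_colLen.2 h1))
  · exact lt_irrefl _ (YoungDiagram.mem_iff_lt_colLen.1 ((h _).2 h1))

@[simp]
theorem colLen_consCol {k : ℕ} {nu : YoungDiagram} {h : nu.colLen 0 ≤ k} :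
    (consCol k nu h).colLen 0 = k :=
  colLen_eq_of_forall fun _ => zero_mem_consCol

theorem colLen_dropCol (nu : YoungDiagram) (j : ℕ) : (dropCol nu).colLen j = nu.colLen (j + 1) :=
  colLen_eq_of_forall fun i => by rw [mem_dropCol, YoungDiagram.mem_iff_lt_colLen]

theorem colLen_mono {mu nu : YoungDiagram} (h : mu ≤ nu) (j : ℕ) : mu.colLen j ≤ nu.colLen j := by
  by_contra! h1
  exact lt_irrefl _ (YoungDiagram.mem_iff_lt_colLen.1 (h (YoungDiagram.mem_iff_lt_colLen.2 h1)))

theorem dropCol_mono {mu nu : YoungDiagram} (h : mu ≤ nu) : dropCol mu ≤ dropCol nu := by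
  rintro ⟨i, j⟩ hc
  exact mem_dropCol.2 (h (mem_dropCol.1 hc))

@[simp]
theorem dropCol_consCol {k : ℕ} {nu : YoungDiagram} {h : nu.colLen 0 ≤ k} :
    dropCol (consCol k nu h) = nu := by
  refine SetLike.ext ?_
  rintro ⟨i, j⟩
  rw [mem_dropCol, succ_mem_consCol]

theorem eq_of_dropCol_eq {mu nu : YoungDiagram} (h : dropCol mu = dropCol nu)
    (h0 : mu.colLen 0 = nu.colLen 0) : mu = nu := by
  refine SetLike.ext ?_
  rintro ⟨i, _ | j⟩
  · rw [YoungDiagram.mem_iff_lt_colLen, YoungDiagram.mem_iff_lt_colLen, h0]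
  · rw [← mem_dropCol, ← mem_dropCol, h]

theorem le_consCol_iff {k : ℕ} {mu nu : YoungDiagram} {h : nu.colLen 0 ≤ k} :
    mu ≤ consCol k nu h ↔ mu.colLen 0 ≤ k ∧ dropCol mu ≤ nu := by
  constructor
  · intro h1
    exact ⟨(colLen_mono h1 0).trans_eq colLen_consCol, (dropCol_mono h1).trans_eq dropCol_consCol⟩
  · rintro ⟨h1, h2⟩ ⟨i, _ | j⟩ hc
    · rw [YoungDiagram.mem_iff_lt_colLen] at hc
      exact zero_mem_consCol.2 (by omega)
    · exact succ_mem_consCol.2 (h2 (mem_dropCol.2 hc))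

theorem consCol_le_iff {k : ℕ} {mu nu : YoungDiagram} {h : nu.colLen 0 ≤ k} :
    consCol k nu h ≤ mu ↔ k ≤ mu.colLen 0 ∧ nu ≤ dropCol mu := by
  constructor
  · intro h1
    exact ⟨colLen_consCol.symm.trans_le (colLen_mono h1 0),
      dropCol_consCol.symm.trans_le (dropCol_mono h1)⟩
  · rintro ⟨h1, h2⟩ ⟨i, _ | j⟩ hc
    · exact YoungDiagram.mem_iff_lt_colLen.2 ((zero_mem_consCol.1 hc).trans_le h1)
    · exact mem_dropCol.1 (h2 (succ_mem_consCol.1 hc))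

theorem card_dropCol_lt {nu : YoungDiagram} (h : nu ≠ ⊥) : (dropCol nu).card < nu.card := by
  have h00 : (0, 0) ∈ nu := by
    by_contra h1
    refine h (le_bot_iff.1 ?_)
    rintro ⟨i, j⟩ hc
    exact absurd (nu.up_left_mem (Nat.zero_le _) (Nat.zero_le _) hc) h1
  have h1 : (dropCol nu).card = ((dropCol nu).cells.image (fun c => (c.1, c.2 + 1))).card := by
    rw [Finset.card_image_of_injective]
    rintro ⟨a, b⟩ ⟨c, d⟩ h
    simpa using h
  rw [h1]
  refine Finset.card_lt_card ⟨?_, fun h2 => ?_⟩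
  · rintro ⟨i, j⟩ hc
    obtain ⟨⟨a, b⟩, hab, h3⟩ := Finset.mem_image.1 hc
    rw [← h3]
    exact mem_dropCol.1 hab
  · have := h2 h00
    simp at this

/-! ### The number of columns of a skew shape -/

@[simp]
theorem mem_skewCells {lam mu : YoungDiagram} {c : ℕ × ℕ} :
    c ∈ skewCells lam mu ↔ c ∈ lam ∧ c ∉ mu := by
  simp [skewCells]

/-- The number of nonempty columns of a skew shape. -/
def numCols (lam mu : YoungDiagram) : ℕ := ((skewCells lam mu).image Prod.snd).card

theorem mem_image_snd_skewCells {lam mu : YoungDiagram} {j : ℕ} :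
    j ∈ (skewCells lam mu).image Prod.snd ↔ mu.colLen j < lam.colLen j := by
  simp only [Finset.mem_image, mem_skewCells, Prod.exists, exists_eq_right,
    YoungDiagram.mem_iff_lt_colLen]
  exact ⟨fun ⟨a, h1, h2⟩ => by omega, fun h => ⟨_, h, lt_irrefl _⟩⟩

theorem numCols_eq (lam mu : YoungDiagram) :
    numCols lam mu = (if mu.colLen 0 < lam.colLen 0 then 1 else 0) +
      numCols (dropCol lam) (dropCol mu) := by
  have h : (skewCells lam mu).image Prod.snd = (if mu.colLen 0 < lam.colLen 0 then {0} else ∅) ∪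
      ((skewCells (dropCol lam) (dropCol mu)).image Prod.snd).map ⟨Nat.succ, Nat.succ_injective⟩ := by
    ext j
    rw [Finset.mem_union, mem_image_snd_skewCells]
    rcases j with _ | j
    · by_cases h : mu.colLen 0 < lam.colLen 0 <;> simp [h]
    · simp only [Finset.mem_map, mem_image_snd_skewCells, colLen_dropCol]
      split_ifs <;> simp
  rw [numCols, h, Finset.card_union_of_disjoint, Finset.card_map]
  · congr 1
    split_ifs <;> simp
  · split_ifs <;> simp

theorem numCols_eq_zero {lam mu : YoungDiagram} : numCols lam mu = 0 ↔ lam ≤ mu := by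
  rw [numCols, Finset.card_eq_zero, Finset.image_eq_empty, skewCells, Finset.sdiff_eq_empty_iff_subset,
    YoungDiagram.cells_subset_iff]

/-! ### The two-variable generating function of an interval -/

section Interval

variable {R : Type*} [CommRing R]

/-- The two-variable generating function of the interval from `mu` to `lam`, restricted to
diagrams whose first column has length at most `n`. -/
def colGen (x y : R) (mu lam : YoungDiagram) (n : ℕ) : R :=
  ∑ nu ∈ Finset.Icc mu lam with nu.colLen 0 ≤ n, x ^ numCols nu mu * y ^ numCols lam nu

theorem colGen_of_le (x y : R) {mu lam : YoungDiagram} {n : ℕ} (h : lam.colLen 0 ≤ n) :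
    colGen x y mu lam n = ∑ nu ∈ Finset.Icc mu lam, x ^ numCols nu mu * y ^ numCols lam nu := by
  rw [colGen, Finset.filter_true_of_mem]
  intro nu hnu
  exact (colLen_mono (Finset.mem_Icc.1 hnu).2 0).trans h

/-- A diagram with first column `k` is the same as its remaining columns, the first of which has
length at most `k`; this bound is why `colGen` carries a truncation. The first column itself is
nonempty in `nu / mu` when `k` exceeds that of `mu`, and in `lam / nu` when `k` is less than that of
`lam`. -/
theorem sum_colLen_eq (x y : R) {mu lam : YoungDiagram} {k : ℕ}
    (h1 : mu.colLen 0 ≤ k) (h2 : k ≤ lam.colLen 0) :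
    ∑ nu ∈ Finset.Icc mu lam with nu.colLen 0 = k, x ^ numCols nu mu * y ^ numCols lam nu =
      (if mu.colLen 0 < k then x else 1) * (if k < lam.colLen 0 then y else 1) *
        colGen x y (dropCol mu) (dropCol lam) k := by
  rw [colGen, Finset.mul_sum]
  refine Finset.sum_bij' (fun nu _ => dropCol nu)
    (fun nu hnu => consCol k nu (Finset.mem_filter.1 hnu).2) ?_ ?_ ?_ ?_ ?_
  · intro nu hnu
    simp only [Finset.mem_filter, Finset.mem_Icc] at hnu ⊢
    refine ⟨⟨dropCol_mono hnu.1.1, dropCol_mono hnu.1.2⟩, ?_⟩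
    rw [colLen_dropCol, ← hnu.2]
    exact nu.colLen_anti _ _ (Nat.zero_le _)
  · intro nu hnu
    simp only [Finset.mem_filter, Finset.mem_Icc] at hnu ⊢
    exact ⟨⟨le_consCol_iff.2 ⟨h1, hnu.1.1⟩, consCol_le_iff.2 ⟨h2, hnu.1.2⟩⟩, colLen_consCol⟩
  · intro nu hnu
    exact eq_of_dropCol_eq dropCol_consCol (colLen_consCol.trans (Finset.mem_filter.1 hnu).2.symm)
  · intro nu hnu
    exact dropCol_consCol
  · intro nu hnu
    rw [numCols_eq nu mu, numCols_eq lam nu, (Finset.mem_filter.1 hnu).2]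
    split_ifs <;> ring

theorem colGen_succ (x y : R) (mu lam : YoungDiagram) (n : ℕ) :
    colGen x y mu lam (n + 1) = colGen x y mu lam n +
      ∑ nu ∈ Finset.Icc mu lam with nu.colLen 0 = n + 1,
        x ^ numCols nu mu * y ^ numCols lam nu := by
  classical
  rw [colGen, colGen, ← Finset.sum_union]
  · congr 1
    ext nu
    simp only [Finset.mem_filter, Finset.mem_union, Nat.le_succ_iff]
    tauto
  · rw [Finset.disjoint_filter]
    intro nu _ h
    omega

theorem colGen_colLen (x y : R) (mu lam : YoungDiagram) :
    colGen x y mu lam (mu.colLen 0) =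
      ∑ nu ∈ Finset.Icc mu lam with nu.colLen 0 = mu.colLen 0,
        x ^ numCols nu mu * y ^ numCols lam nu := by
  rw [colGen]
  congr 1
  refine Finset.filter_congr fun nu hnu => ?_
  have := colLen_mono (Finset.mem_Icc.1 hnu).1 0
  omega

/-- The algebraic core of the symmetry of `colGen`: one step of the recursion on columns. -/
theorem symm_step {x y : R} {f f' g g' : ℕ → R} {m l : ℕ} (hml : m ≤ l)
    (hm : f m = (if m < l then y else 1) * g m) (hm' : f' m = (if m < l then x else 1) * g' m)
    (hs : ∀ n, m ≤ n → n + 1 < l → f (n + 1) = f n + x * y * g (n + 1))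
    (hs' : ∀ n, m ≤ n → n + 1 < l → f' (n + 1) = f' n + x * y * g' (n + 1))
    (he : ∀ n, m ≤ n → n + 1 = l → f (n + 1) = f n + x * g (n + 1))
    (he' : ∀ n, m ≤ n → n + 1 = l → f' (n + 1) = f' n + y * g' (n + 1))
    (hc : ∀ n, l ≤ n → f n = f l) (hc' : ∀ n, l ≤ n → f' n = f' l)
    (hg : g l = g' l)
    (ht : ∀ a, m ≤ a → y * g a - y * g (a + 1) + x * y * g (a + 1) =
      x * g' a - x * g' (a + 1) + x * y * g' (a + 1)) :
    -- Below `l` the second expression is `x * y` times the invariant at `a + 1`; at `a + 1 = l` it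
    -- is `x * y * (f l - g l)`; beyond `l` it is `x * y * f l`.
    f l = f' l ∧ ∀ a, m ≤ a → y * f a - y * f (a + 1) + x * y * f (a + 1) =
      x * f' a - x * f' (a + 1) + x * y * f' (a + 1) := by
  -- The invariant `f n - y * g n` is zero at `m`, and each step adds exactly the expression that
  -- `ht` declares symmetric.
  have h1 : ∀ n, m ≤ n → n < l → f n - y * g n = f' n - x * g' n := by
    intro n hn
    induction n, hn using Nat.le_induction with
    | base =>
      intro h
      rw [hm, hm', if_pos h, if_pos h]
      ring
    | succ n hn ih =>
      intro h
      rw [hs n hn h, hs' n hn h]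
      linear_combination ih (by omega) + ht n hn
  -- The last step has coefficient `x` instead of `x * y`. The excess over the invariant is the
  -- symmetric multiple `(x + y - x * y) * g l`.
  have h2 : f l = f' l := by
    rcases hml.eq_or_lt with rfl | h
    · simpa [hm, hm'] using hg
    · obtain ⟨n, rfl⟩ : ∃ n, l = n + 1 := ⟨l - 1, by omega⟩
      rw [he n (by omega) rfl, he' n (by omega) rfl]
      linear_combination h1 n (by omega) (by omega) + ht n (by omega) + (x + y - x * y) * hg
  refine ⟨h2, fun a ha => ?_⟩
  rcases lt_trichotomy (a + 1) l with h | h | h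
  · rw [hs a ha h, hs' a ha h]
    have := h1 (a + 1) (by omega) h
    rw [hs a ha h, hs' a ha h] at this
    linear_combination x * y * this
  · have e := he a ha h
    have e' := he' a ha h
    rw [h] at e e' ⊢
    linear_combination (-y) * e + x * e' + (x * y) * h2 - x * y * hg
  · rw [hc a (by omega), hc' a (by omega), hc (a + 1) (by omega), hc' (a + 1) (by omega), h2]
    ring

/-- The truncated sums are not symmetric in general, so symmetry of the full sum cannot be fed back
into the column recursion alone. The second identity, between consecutive truncations, is the
strengthening that makes the induction close. -/
theorem colGen_symm_aux (x y : R) (N : ℕ) : ∀ mu lam : YoungDiagram, lam.card ≤ N → mu ≤ lam →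
    (∀ n, lam.colLen 0 ≤ n → colGen x y mu lam n = colGen y x mu lam n) ∧
    ∀ a, mu.colLen 0 ≤ a → y * colGen x y mu lam a - y * colGen x y mu lam (a + 1) +
        x * y * colGen x y mu lam (a + 1) =
      x * colGen y x mu lam a - x * colGen y x mu lam (a + 1) +
        x * y * colGen y x mu lam (a + 1) := by
  induction N with
  | zero =>
    intro mu lam h hle
    obtain rfl : lam = ⊥ := YoungDiagram.ext (by simpa using h)
    obtain rfl : mu = ⊥ := le_bot_iff.1 hle
    have hb : (⊥ : YoungDiagram).colLen 0 = 0 := colLen_eq_of_forall (by simp)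
    have h0 : numCols ⊥ ⊥ = 0 := numCols_eq_zero.2 le_rfl
    have : ∀ (u v : R) n, colGen u v ⊥ ⊥ n = 1 := by
      intro u v n
      rw [colGen_of_le _ _ (by omega)]
      simp [h0]
    simp [this]
  | succ N ih =>
    intro mu lam hN hle
    -- Deleting the first column reduces the number of cells only when the diagram is nonempty.
    by_cases hbot : lam = ⊥
    · subst hbot
      exact ih mu ⊥ (by simp [YoungDiagram.card]) hle
    obtain ⟨ih1, ih2⟩ := ih (dropCol mu) (dropCol lam)
      (by have := card_dropCol_lt hbot; omega) (dropCol_mono hle)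
    have hml := colLen_mono hle 0
    have hl' : (dropCol lam).colLen 0 ≤ lam.colLen 0 := by
      rw [colLen_dropCol]
      exact lam.colLen_anti _ _ (Nat.zero_le _)
    have hm' : (dropCol mu).colLen 0 ≤ mu.colLen 0 := by
      rw [colLen_dropCol]
      exact mu.colLen_anti _ _ (Nat.zero_le _)
    have key : ∀ u v : R,
        colGen u v mu lam (mu.colLen 0) = (if mu.colLen 0 < lam.colLen 0 then v else 1) *
          colGen u v (dropCol mu) (dropCol lam) (mu.colLen 0) ∧
        (∀ n, mu.colLen 0 ≤ n → n + 1 < lam.colLen 0 → colGen u v mu lam (n + 1) =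
          colGen u v mu lam n + u * v * colGen u v (dropCol mu) (dropCol lam) (n + 1)) ∧
        (∀ n, mu.colLen 0 ≤ n → n + 1 = lam.colLen 0 → colGen u v mu lam (n + 1) =
          colGen u v mu lam n + u * colGen u v (dropCol mu) (dropCol lam) (n + 1)) ∧
        (∀ n, lam.colLen 0 ≤ n → colGen u v mu lam n = colGen u v mu lam (lam.colLen 0)) := by
      intro u v
      refine ⟨?_, fun n h1 h2 => ?_, fun n h1 h2 => ?_, fun n h => ?_⟩
      · rw [colGen_colLen, sum_colLen_eq _ _ le_rfl hml, if_neg (lt_irrefl _), one_mul]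
      · rw [colGen_succ, sum_colLen_eq _ _ (by omega) (by omega), if_pos (by omega), if_pos h2]
      · rw [colGen_succ, sum_colLen_eq _ _ (by omega) (by omega), if_pos (by omega),
          if_neg (by omega), mul_one]
      · rw [colGen_of_le _ _ h, colGen_of_le _ _ le_rfl]
    obtain ⟨k1, k2, k3, k4⟩ := key x y
    obtain ⟨k1', k2', k3', k4'⟩ := key y x
    rw [mul_comm y x] at k2'
    obtain ⟨r1, r2⟩ := symm_step hml k1 k1' k2 k2' k3 k3' k4 k4' (ih1 _ hl')
      (fun a ha => ih2 a (hm'.trans ha))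
    refine ⟨fun n hn => ?_, r2⟩
    rw [k4 n hn, k4' n hn, r1]

/-- The two-variable generating function of an interval of Young's lattice is symmetric. -/
theorem sum_Icc_symm (x y : R) {mu lam : YoungDiagram} (h : mu ≤ lam) :
    ∑ nu ∈ Finset.Icc mu lam, x ^ numCols nu mu * y ^ numCols lam nu =
      ∑ nu ∈ Finset.Icc mu lam, y ^ numCols nu mu * x ^ numCols lam nu := by
  rw [← colGen_of_le x y le_rfl, ← colGen_of_le y x le_rfl]
  exact (colGen_symm_aux x y _ mu lam le_rfl h).1 _ le_rfl

end Interval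

/-! ### The transfer operators -/

section Transfer

variable (K : Type*) [CommRing K]

open Classical in
/-- The element of the incidence algebra of Young's lattice marking the skew shapes with exactly
`k` nonempty columns. -/
def colOp (k : ℕ) : IncidenceAlgebra K YoungDiagram where
  toFun mu lam := if mu ≤ lam ∧ numCols lam mu = k then 1 else 0
  eq_zero_of_not_le' _ _ h := if_neg fun h1 => h h1.1

open Classical in
theorem colOp_apply {k : ℕ} {mu lam : YoungDiagram} (h : mu ≤ lam) :
    colOp K k mu lam = if numCols lam mu = k then 1 else 0 := by
  change (if mu ≤ lam ∧ numCols lam mu = k then (1 : K) else 0) = _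
  simp [h]

open Classical in
theorem colOp_zero : colOp K 0 = 1 := by
  ext mu lam h
  have h1 : numCols lam mu = 0 ↔ mu = lam := by
    rw [numCols_eq_zero]
    exact ⟨fun h1 => le_antisymm h h1, fun h1 => h1.ge⟩
  rw [colOp_apply K h, IncidenceAlgebra.one_apply]
  simp only [h1]

/-- Compare the coefficients of `X 0 ^ a * X 1 ^ b` in `sum_Icc_symm`, taken over the polynomial
ring in two variables. -/
theorem colOp_comm (a b : ℕ) : colOp K a * colOp K b = colOp K b * colOp K a := by
  classical
  ext mu lam h
  have key := congrArg (MvPolynomial.coeff (Finsupp.single (0 : Fin 2) a + Finsupp.single 1 b))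
    (sum_Icc_symm (R := MvPolynomial (Fin 2) K) (MvPolynomial.X 0) (MvPolynomial.X 1) h)
  have hX : ∀ p q : ℕ, (MvPolynomial.X 0 ^ p * MvPolynomial.X 1 ^ q : MvPolynomial (Fin 2) K) =
      MvPolynomial.monomial (Finsupp.single 0 p + Finsupp.single 1 q) 1 := by
    intro p q
    rw [MvPolynomial.X_pow_eq_monomial, MvPolynomial.X_pow_eq_monomial, MvPolynomial.monomial_mul,
      one_mul]
  have hs : ∀ p q r s : ℕ, (Finsupp.single (0 : Fin 2) p + Finsupp.single 1 q =
      Finsupp.single 0 r + Finsupp.single 1 s) ↔ p = r ∧ q = s := by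
    intro p q r s
    constructor
    · intro h
      have h0 := DFunLike.congr_fun h 0
      have h1 := DFunLike.congr_fun h 1
      simp at h0 h1
      exact ⟨h0, h1⟩
    · rintro ⟨rfl, rfl⟩
      rfl
  have hX' : ∀ p q : ℕ, (MvPolynomial.X 1 ^ p * MvPolynomial.X 0 ^ q : MvPolynomial (Fin 2) K) =
      MvPolynomial.monomial (Finsupp.single 0 q + Finsupp.single 1 p) 1 := by
    intro p q
    rw [mul_comm, hX]
  simp only [hX, hX', MvPolynomial.coeff_sum, MvPolynomial.coeff_monomial, hs] at key
  rw [IncidenceAlgebra.mul_apply, IncidenceAlgebra.mul_apply]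
  refine Eq.trans (Finset.sum_congr rfl fun nu hnu => ?_)
    (key.trans (Finset.sum_congr rfl fun nu hnu => ?_))
  all_goals
    rw [colOp_apply K (Finset.mem_Icc.1 hnu).1, colOp_apply K (Finset.mem_Icc.1 hnu).2,
      ite_zero_mul_ite_zero, mul_one]
  simp only [and_comm]

open Classical in
/-- The commutative subring of the incidence algebra generated by the transfer operators. -/
def colRing : Subring (IncidenceAlgebra K YoungDiagram) :=
  Subring.closure (Set.range (colOp K))

-- A product indexed by a finitely supported function is defined only in a commutative monoid, which
-- the full incidence algebra is not.
open Classical in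
instance instCommRingColRing : CommRing (colRing K) :=
  have : IsMulCommutative (colRing K) := Subring.isMulCommutative_closure (by
    rintro _ ⟨a, rfl⟩ _ ⟨b, rfl⟩
    exact colOp_comm K a b)
  { (inferInstance : Ring (colRing K)) with mul_comm := this.is_comm.comm }

open Classical in
/-- The transfer operator as an element of the commutative ring `colRing K`. -/
def colElt (k : ℕ) : colRing K := ⟨colOp K k, Subring.subset_closure ⟨k, rfl⟩⟩

open Classical in
/-- The product of the transfer operators for the exponents of `d`. -/
def colProd (d : ℕ →₀ ℕ) : IncidenceAlgebra K YoungDiagram :=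
  ((d.prod fun _ k => colElt K k : colRing K) : IncidenceAlgebra K YoungDiagram)

theorem colElt_zero : colElt K 0 = 1 := Subtype.ext (colOp_zero K)

open Classical in
theorem colProd_zero : colProd K 0 = 1 := by
  simp [colProd]

/-- This is the source of all symmetry in the file: a commutative product does not see which
variable carries which exponent. -/
theorem colProd_mapDomain (σ : Equiv.Perm ℕ) (d : ℕ →₀ ℕ) :
    colProd K (d.mapDomain σ) = colProd K d := by
  rw [colProd, colProd, ← Equiv.coe_toEmbedding σ, ← Finsupp.embDomain_eq_mapDomain,
    Finsupp.prod_embDomain]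

theorem colProd_add_single {d : ℕ →₀ ℕ} {n : ℕ} (h : d n = 0) (k : ℕ) :
    colProd K (d + Finsupp.single n k) = colProd K d * colOp K k := by
  classical
  have h1 : (d + Finsupp.single n k).prod (fun _ k => colElt K k) =
      d.prod (fun _ k => colElt K k) * colElt K k := by
    rw [Finsupp.prod_add_index_of_disjoint, Finsupp.prod_single_index (colElt_zero K)]
    refine Disjoint.mono_right Finsupp.support_single_subset ?_
    simpa using h
  rw [colProd, h1]
  rfl

theorem colProd_add_single' {d : ℕ →₀ ℕ} {n : ℕ} (h : d n = 0) (k : ℕ) :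
    colProd K (d + Finsupp.single n k) = colOp K k * colProd K d := by
  classical
  rw [colProd_add_single K h, colProd]
  exact congrArg Subtype.val (mul_comm (d.prod fun _ k => colElt K k) (colElt K k))

end Transfer

/-! ### Reverse plane partitions -/

namespace ReversePlanePartition

variable {lam mu nu : YoungDiagram}

/-- The whole rectangle between the two cells lies in the skew shape, so one may go along a row to
`(i', j)` and then down a column. -/
theorem entry_mono (T : ReversePlanePartition lam mu) {i i' j j' : ℕ} (hi : i' ≤ i) (hj : j' ≤ j)
    (h : (i, j) ∈ lam) (h' : (i', j') ∉ mu) : T.entry i' j' ≤ T.entry i j := by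
  have h1 : (i', j) ∈ skewCells lam mu :=
    mem_skewCells.2 ⟨lam.up_left_mem hi le_rfl h, fun h2 => h' (mu.up_left_mem le_rfl hj h2)⟩
  have h2 : (i', j') ∈ skewCells lam mu := mem_skewCells.2 ⟨lam.up_left_mem hi hj h, h'⟩
  have h3 : (i, j) ∈ skewCells lam mu :=
    mem_skewCells.2 ⟨h, fun h2 => h' (mu.up_left_mem hi hj h2)⟩
  refine (?_ : T.entry i' j' ≤ T.entry i' j).trans ?_
  · rcases hj.eq_or_lt with rfl | hj
    · rfl
    · exact T.row_weak hj h2 h1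
  · rcases hi.eq_or_lt with rfl | hi
    · rfl
    · exact T.col_weak hi h1 h3

theorem weight_apply (T : ReversePlanePartition lam mu) (k : ℕ) :
    T.weight k =
      (((skewCells lam mu).filter fun c => T.entry c.1 c.2 = k).image Prod.snd).card := by
  have h : T.weight k = (((skewCells lam mu).image fun c => (T.entry c.1 c.2, c.2)).filter
      fun p => p.1 = k).card := by
    simp only [weight, Finsupp.coe_finsetSum, Finset.sum_apply, Finsupp.single_apply,
      Finset.card_filter]
  rw [h, Finset.filter_image, ← Finset.card_image_of_injOn (f := Prod.snd), Finset.image_image]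
  · rfl
  · rintro ⟨a, b⟩ h1 ⟨c, d⟩ h2 (rfl : b = d)
    simp only [Finset.coe_image, Finset.coe_filter, Set.mem_image, Set.mem_ofPred_eq,
      Prod.mk.injEq] at h1 h2
    obtain ⟨_, ⟨_, h3⟩, h4, _⟩ := h1
    obtain ⟨_, ⟨_, h5⟩, h6, _⟩ := h2
    rw [← h4, ← h6, h3, h5]

theorem weight_eq_zero_iff (T : ReversePlanePartition lam mu) {k : ℕ} :
    T.weight k = 0 ↔ ∀ c ∈ skewCells lam mu, T.entry c.1 c.2 ≠ k := by
  rw [weight_apply, Finset.card_eq_zero, Finset.image_eq_empty, Finset.filter_eq_empty_iff]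

theorem degree_weight (T : ReversePlanePartition lam mu) :
    T.weight.degree = ((skewCells lam mu).image fun c => (T.entry c.1 c.2, c.2)).card := by
  rw [weight, map_sum, Finset.card_eq_sum_ones]
  exact Finset.sum_congr rfl fun p _ => Finsupp.degree_single _ _

theorem degree_weight_le (T : ReversePlanePartition lam mu) :
    T.weight.degree ≤ (skewCells lam mu).card :=
  T.degree_weight.trans_le Finset.card_image_le

/-- The diagram consisting of `mu` and the cells with entry less than `n`. -/
def below (T : ReversePlanePartition lam mu) (n : ℕ) : YoungDiagram where
  cells := mu.cells ∪ (skewCells lam mu).filter fun c => T.entry c.1 c.2 < n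
  isLowerSet := by
    rintro ⟨i, j⟩ ⟨i', j'⟩ hle hc
    simp only [Finset.coe_union, Set.mem_union, Finset.mem_coe, YoungDiagram.mem_cells,
      Finset.mem_filter, mem_skewCells] at hc ⊢
    by_cases h' : (i', j') ∈ mu
    · exact Or.inl h'
    · rcases hc with hc | ⟨hc, h⟩
      · exact absurd (mu.up_left_mem hle.1 hle.2 hc) h'
      · exact Or.inr ⟨⟨lam.up_left_mem hle.1 hle.2 hc.1, h'⟩,
          (T.entry_mono hle.1 hle.2 hc.1 h').trans_lt h⟩

theorem mem_below (T : ReversePlanePartition lam mu) {n : ℕ} {c : ℕ × ℕ} :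
    c ∈ T.below n ↔ c ∈ mu ∨ (c ∈ lam ∧ c ∉ mu) ∧ T.entry c.1 c.2 < n := by
  rw [← YoungDiagram.mem_cells]
  simp [below]

open Classical in
/-- Restriction of a reverse plane partition to a smaller outer shape. -/
def restrict (T : ReversePlanePartition lam mu) (h : nu ≤ lam) : ReversePlanePartition nu mu where
  entry i j := if (i, j) ∈ nu then T.entry i j else 0
  row_weak {i j₁ j₂} hj h1 h2 := by
    rw [mem_skewCells] at h1 h2
    rw [if_pos h1.1, if_pos h2.1]
    exact T.entry_mono le_rfl hj.le (h h2.1) h1.2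
  col_weak {i₁ i₂ j} hi h1 h2 := by
    rw [mem_skewCells] at h1 h2
    rw [if_pos h1.1, if_pos h2.1]
    exact T.entry_mono hi.le le_rfl (h h2.1) h1.2
  zeros {i j} h1 := by
    split_ifs with h2
    · refine T.zeros fun h3 => h1 ?_
      rw [mem_skewCells] at h3 ⊢
      exact ⟨h2, h3.2⟩
    · rfl

open Classical in
/-- Extension of a reverse plane partition with entries less than `n` to a larger outer shape by
filling the new cells with `n`. -/
def extend (T : ReversePlanePartition nu mu) (hmu : mu ≤ nu) (hnu : nu ≤ lam) (n : ℕ)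
    (hT : ∀ c ∈ skewCells nu mu, T.entry c.1 c.2 < n) : ReversePlanePartition lam mu where
  entry i j := if (i, j) ∈ nu then T.entry i j else if (i, j) ∈ lam then n else 0
  row_weak {i j₁ j₂} hj h1 h2 := by
    rw [mem_skewCells] at h1 h2
    rw [if_pos h1.1, if_pos h2.1]
    by_cases h3 : (i, j₂) ∈ nu
    · rw [if_pos h3, if_pos (nu.up_left_mem le_rfl hj.le h3)]
      exact T.entry_mono le_rfl hj.le h3 h1.2
    · rw [if_neg h3]
      split_ifs with h4
      · exact (hT _ (mem_skewCells.2 ⟨h4, h1.2⟩)).le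
      · rfl
  col_weak {i₁ i₂ j} hi h1 h2 := by
    rw [mem_skewCells] at h1 h2
    rw [if_pos h1.1, if_pos h2.1]
    by_cases h3 : (i₂, j) ∈ nu
    · rw [if_pos h3, if_pos (nu.up_left_mem hi.le le_rfl h3)]
      exact T.entry_mono hi.le le_rfl h3 h1.2
    · rw [if_neg h3]
      split_ifs with h4
      · exact (hT _ (mem_skewCells.2 ⟨h4, h1.2⟩)).le
      · rfl
  zeros {i j} h1 := by
    rw [mem_skewCells, not_and, not_not] at h1
    split_ifs with h2 h3
    · refine T.zeros fun h3 => ?_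
      rw [mem_skewCells] at h3
      exact h3.2 (h1 (hnu h2))
    · exact absurd (hmu (h1 h3)) h2
    · rfl

section Extend

variable (T : ReversePlanePartition nu mu) (hmu : mu ≤ nu) (hnu : nu ≤ lam) (n : ℕ)
  (hT : ∀ c ∈ skewCells nu mu, T.entry c.1 c.2 < n)

theorem extend_entry_of_mem {c : ℕ × ℕ} (h : c ∈ nu) :
    (T.extend hmu hnu n hT).entry c.1 c.2 = T.entry c.1 c.2 :=
  if_pos h

theorem extend_entry_of_notMem {c : ℕ × ℕ} (h : c ∈ lam) (h' : c ∉ nu) :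
    (T.extend hmu hnu n hT).entry c.1 c.2 = n :=
  (if_neg h').trans (if_pos h)

theorem below_extend : (T.extend hmu hnu n hT).below n = nu := by
  refine SetLike.ext fun c => ?_
  rw [mem_below]
  by_cases h : c ∈ nu
  · rw [extend_entry_of_mem _ _ _ _ _ h]
    refine iff_of_true ?_ h
    by_cases h1 : c ∈ mu
    · exact Or.inl h1
    · exact Or.inr ⟨⟨hnu h, h1⟩, hT c (mem_skewCells.2 ⟨h, h1⟩)⟩
  · refine iff_of_false ?_ h
    rintro (h1 | ⟨h1, h2⟩)
    · exact h (hmu h1)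
    · rw [extend_entry_of_notMem _ _ _ _ _ h1.1 h] at h2
      exact lt_irrefl _ h2

theorem weight_extend :
    (T.extend hmu hnu n hT).weight = T.weight + Finsupp.single n (numCols lam nu) := by
  ext k
  rw [Finsupp.add_apply, weight_apply]
  by_cases hk : k = n
  · subst hk
    rw [T.weight_eq_zero_iff.2 fun c hc => (hT c hc).ne, Finsupp.single_eq_same, zero_add, numCols]
    congr 2
    ext c
    simp only [Finset.mem_filter, mem_skewCells]
    constructor
    · rintro ⟨⟨h1, h2⟩, h3⟩
      refine ⟨h1, fun h4 => ?_⟩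
      rw [extend_entry_of_mem _ _ _ _ _ h4] at h3
      exact (hT c (mem_skewCells.2 ⟨h4, h2⟩)).ne h3
    · rintro ⟨h1, h2⟩
      exact ⟨⟨h1, fun h3 => h2 (hmu h3)⟩, extend_entry_of_notMem _ _ _ _ _ h1 h2⟩
  · rw [weight_apply, Finsupp.single_eq_of_ne hk, add_zero]
    congr 2
    ext c
    simp only [Finset.mem_filter, mem_skewCells]
    constructor
    · rintro ⟨⟨h1, h2⟩, h3⟩
      by_cases h4 : c ∈ nu
      · rw [extend_entry_of_mem _ _ _ _ _ h4] at h3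
        exact ⟨⟨h4, h2⟩, h3⟩
      · rw [extend_entry_of_notMem _ _ _ _ _ h1 h4] at h3
        exact absurd h3.symm hk
    · rintro ⟨⟨h1, h2⟩, h3⟩
      exact ⟨⟨hnu h1, h2⟩, by rw [extend_entry_of_mem _ _ _ _ _ h1, h3]⟩

end Extend

theorem entry_lt_of_weight {n : ℕ} {T : ReversePlanePartition lam mu}
    (h : ∀ m, n ≤ m → T.weight m = 0) {c : ℕ × ℕ} (hc : c ∈ skewCells lam mu) :
    T.entry c.1 c.2 < n := by
  by_contra! h1
  exact T.weight_eq_zero_iff.1 (h _ h1) c hc rfl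

open Classical in
/-- A reverse plane partition with largest possible entry `n` is determined by the shape of its
entries less than `n` and their filling. -/
def weightEquiv (h : mu ≤ lam) (n k : ℕ) (d : ℕ →₀ ℕ) (hd : ∀ m, n ≤ m → d m = 0) :
    (Σ nu : {nu // nu ∈ (Finset.Icc mu lam).filter fun nu => numCols lam nu = k},
      {T : ReversePlanePartition nu mu // T.weight = d}) ≃
    {T : ReversePlanePartition lam mu // T.weight = d + Finsupp.single n k} :=
  Equiv.ofBijective (fun p =>
    have hp := Finset.mem_filter.1 p.1.2
    have hI := Finset.mem_Icc.1 hp.1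
    ⟨p.2.1.extend hI.1 hI.2 n
      (fun _ hc => entry_lt_of_weight (fun m hm => by rw [p.2.2, hd m hm]) hc), by
      rw [weight_extend, p.2.2, hp.2]⟩) (by
    constructor
    · rintro ⟨⟨nu, hnu⟩, T, hT⟩ ⟨⟨nu', hnu'⟩, T', hT'⟩ heq
      have h1 := congrArg Subtype.val heq
      simp only at h1
      have h2 := congrArg (fun S => below S n) h1
      simp only [below_extend] at h2
      subst h2
      have h3 : T = T' := by
        ext i j
        by_cases h4 : (i, j) ∈ nu
        · have h5 := congrArg (fun S => entry S i j) h1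
          simp only [extend, if_pos h4] at h5
          exact h5
        · rw [T.zeros, T'.zeros] <;> simp [h4]
      subst h3
      rfl
    · rintro ⟨T, hT⟩
      have hle : T.below n ≤ lam := by
        intro c hc
        rcases T.mem_below.1 hc with h1 | h1
        · exact h h1
        · exact h1.1.1
      have hge : mu ≤ T.below n := fun c hc => T.mem_below.2 (Or.inl hc)
      have hlt : ∀ c ∈ skewCells (T.below n) mu, (T.restrict hle).entry c.1 c.2 < n := by
        intro c hc
        rw [mem_skewCells] at hc
        simp only [restrict]
        rw [if_pos hc.1]
        rcases T.mem_below.1 hc.1 with h1 | h1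
        · exact absurd h1 hc.2
        · exact h1.2
      have hext : (T.restrict hle).extend hge hle n hlt = T := by
        ext i j
        simp only [extend, restrict]
        split_ifs with h1 h2
        · rfl
        -- A cell of `lam` outside `T.below n` has entry at least `n`; it is at most `n` because the
        -- weight vanishes beyond `n`.
        · refine le_antisymm (not_lt.1 fun h3 => h1 (T.mem_below.2 (Or.inr ⟨⟨h2, ?_⟩, h3⟩))) ?_
          · exact fun h4 => h1 (hge h4)
          · refine Nat.lt_succ_iff.1 (entry_lt_of_weight (n := n + 1) (fun m hm => ?_)
              (c := (i, j)) (mem_skewCells.2 ⟨h2, fun h4 => h1 (hge h4)⟩))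
            rw [hT, Finsupp.add_apply, hd m (by omega), Finsupp.single_eq_of_ne (by omega), add_zero]
        · exact (T.zeros (by simp [h2])).symm
      have hw := weight_extend _ hge hle n hlt
      rw [hext, hT] at hw
      have hz : (T.restrict hle).weight n = 0 :=
        (weight_eq_zero_iff _).2 fun c hc => (hlt c hc).ne
      -- The exponents of variable `n` are compared: neither `d` nor the restricted filling involves
      -- it.
      have hk : numCols lam (T.below n) = k := by
        have := DFunLike.congr_fun hw n
        simpa [hz, hd n le_rfl] using this.symm
      rw [hk] at hw
      exact ⟨⟨⟨T.below n, Finset.mem_filter.2 ⟨Finset.mem_Icc.2 ⟨hge, hle⟩, hk⟩⟩,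
        T.restrict hle, (add_right_cancel hw).symm⟩, Subtype.ext hext⟩)

-- Induction on a bound for the variables in use: splitting off the cells with entry `n` multiplies
-- on the right by one transfer operator. Finiteness is carried along because `Nat.card` of an
-- infinite type is `0`, so the fibres could not otherwise be added up.
open Classical in
theorem finite_and_card (K : Type*) [CommRing K] (n : ℕ) : ∀ (lam mu : YoungDiagram) (d : ℕ →₀ ℕ),
    mu ≤ lam → (∀ m, n ≤ m → d m = 0) →
    Finite {T : ReversePlanePartition lam mu // T.weight = d} ∧
      (Nat.card {T : ReversePlanePartition lam mu // T.weight = d} : K) = colProd K d mu lam := by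
  induction n with
  | zero =>
    intro lam mu d h hd
    obtain rfl : d = 0 := Finsupp.ext fun m => hd m (Nat.zero_le _)
    have hcell : ∀ T : {T : ReversePlanePartition lam mu // T.weight = 0},
        ∀ c, c ∉ skewCells lam mu := fun T c hc => absurd
      (entry_lt_of_weight (n := 0) (T := T.1) (fun m _ => by rw [T.2]; rfl) hc) (Nat.not_lt_zero _)
    have hsub : Subsingleton {T : ReversePlanePartition lam mu // T.weight = 0} := by
      refine ⟨fun T T' => Subtype.ext ?_⟩
      ext i j
      rw [T.1.zeros (hcell T _), T'.1.zeros (hcell T _)]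
    refine ⟨inferInstance, ?_⟩
    rw [colProd_zero, IncidenceAlgebra.one_apply]
    split_ifs with he
    · subst he
      have : Nonempty {T : ReversePlanePartition mu mu // T.weight = 0} :=
        ⟨⟨⟨fun _ _ => 0, fun _ _ _ => le_rfl, fun _ _ _ => le_rfl, fun _ => rfl⟩, by
          simp [weight, skewCells]⟩⟩
      rw [Nat.card_unique, Nat.cast_one]
    · have : IsEmpty {T : ReversePlanePartition lam mu // T.weight = 0} := by
        refine ⟨fun T => he (le_antisymm h fun c hc => ?_)⟩
        by_contra h1
        exact hcell T c (mem_skewCells.2 ⟨hc, h1⟩)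
      rw [Nat.card_of_isEmpty, Nat.cast_zero]
  | succ n ih =>
    intro lam mu d h hd
    have hd' : ∀ m, n ≤ m → (d.erase n) m = 0 := by
      intro m hm
      rcases hm.eq_or_lt with rfl | hm
      · exact Finsupp.erase_same
      · rw [Finsupp.erase_ne (by omega), hd m hm]
    have hdec : d = d.erase n + Finsupp.single n (d n) := (Finsupp.erase_add_single n d).symm
    rw [hdec]
    have hfin : ∀ nu : {nu // nu ∈ (Finset.Icc mu lam).filter fun nu => numCols lam nu = d n},
        Finite {T : ReversePlanePartition nu mu // T.weight = d.erase n} := fun nu =>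
      (ih nu mu (d.erase n) (Finset.mem_Icc.1 (Finset.mem_filter.1 nu.2).1).1 hd').1
    refine ⟨Finite.of_equiv _ (weightEquiv h n (d n) _ hd'), ?_⟩
    rw [← Nat.card_congr (weightEquiv h n (d n) _ hd'), Nat.card_sigma, Nat.cast_sum,
      colProd_add_single K (hd' n le_rfl), IncidenceAlgebra.mul_apply,
      Finset.sum_coe_sort ((Finset.Icc mu lam).filter fun nu => numCols lam nu = d n)
        (fun nu => (Nat.card {T : ReversePlanePartition nu mu // T.weight = d.erase n} : K)),
      Finset.sum_filter]
    refine Finset.sum_congr rfl fun nu hnu => ?_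
    rw [Finset.mem_Icc] at hnu
    rw [colOp_apply K hnu.2, (ih nu mu _ hnu.1 hd').2, mul_ite, mul_one, mul_zero]

end ReversePlanePartition

/-! ### Symmetry of the dual stable Grothendieck polynomials -/

section

variable (K : Type*) [CommRing K]

theorem exists_forall_ge_eq_zero (d : ℕ →₀ ℕ) : ∃ n, ∀ m, n ≤ m → d m = 0 := by
  refine ⟨d.support.sup id + 1, fun m hm => Finsupp.notMem_support_iff.1 fun h => ?_⟩
  have := Finset.le_sup (f := id) h
  simp only [id] at this
  omega

theorem coeff_dualGrothendieck {lam mu : YoungDiagram} (h : mu ≤ lam) (d : ℕ →₀ ℕ) :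
    coeff d (dualGrothendieck K lam mu) = colProd K d mu lam := by
  obtain ⟨n, hn⟩ := exists_forall_ge_eq_zero d
  exact (ReversePlanePartition.finite_and_card K n lam mu d h hn).2

theorem coeff_dualGrothendieck_of_card_lt {lam mu : YoungDiagram} {d : ℕ →₀ ℕ}
    (h : (skewCells lam mu).card < d.degree) : coeff d (dualGrothendieck K lam mu) = 0 := by
  have : IsEmpty {T : ReversePlanePartition lam mu // T.weight = d} :=
    ⟨fun T => absurd T.1.degree_weight_le (by rw [T.2]; exact not_le.2 h)⟩
  change (Nat.card {T : ReversePlanePartition lam mu // T.weight = d} : K) = 0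
  rw [Nat.card_of_isEmpty, Nat.cast_zero]

theorem dualGrothendieck_mem (lam mu : YoungDiagram) (h : mu ≤ lam) :
    dualGrothendieck K lam mu ∈ SymmFn K := by
  refine ⟨(mem_completed_iff _).2 fun σ d => ?_, (skewCells lam mu).card, fun d hd =>
    coeff_dualGrothendieck_of_card_lt K hd⟩
  rw [coeff_dualGrothendieck K h, coeff_dualGrothendieck K h, colProd_mapDomain]

end

/-! ### Schur functions as top components of dual stable Grothendieck polynomials -/

@[simp]
theorem skewCells_bot (lam : YoungDiagram) : skewCells lam ⊥ = lam.cells := by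
  simp [skewCells]

theorem degree_content {lam : YoungDiagram} (T : SemistandardYoungTableau lam) :
    (content T).degree = lam.card := by
  rw [content, map_sum, YoungDiagram.card, Finset.card_eq_sum_ones]
  exact Finset.sum_congr rfl fun c _ => Finsupp.degree_single _ _

/-- A semistandard tableau as a reverse plane partition. -/
def toReversePlanePartition {lam : YoungDiagram} (T : SemistandardYoungTableau lam) :
    ReversePlanePartition lam ⊥ where
  entry := T
  row_weak hj _ h := T.row_weak hj (mem_skewCells.1 h).1
  col_weak hi _ h := T.col_weak hi.le (mem_skewCells.1 h).1
  zeros h := T.zeros (by simpa using h)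

theorem weight_toReversePlanePartition {lam : YoungDiagram} (T : SemistandardYoungTableau lam) :
    (toReversePlanePartition T).weight = content T := by
  rw [ReversePlanePartition.weight, skewCells_bot, Finset.sum_image]
  · rfl
  · rintro ⟨a, b⟩ h1 ⟨c, d⟩ h2 h
    obtain ⟨h3, rfl⟩ : T a b = T c d ∧ b = d := Prod.mk.inj h
    rcases lt_trichotomy a c with h4 | rfl | h4
    · exact absurd h3 (T.col_strict h4 h2).ne
    · rfl
    · exact absurd h3 (T.col_strict h4 h1).ne'

/-- Semistandard tableaux are the reverse plane partitions of largest possible weight. -/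
def tableauEquiv {lam : YoungDiagram} {d : ℕ →₀ ℕ} (hd : d.degree = lam.card) :
    {T : SemistandardYoungTableau lam // content T = d} ≃
      {T : ReversePlanePartition lam ⊥ // T.weight = d} where
  toFun T := ⟨toReversePlanePartition T.1, (weight_toReversePlanePartition T.1).trans T.2⟩
  invFun T :=
    have hstrict : ∀ {i1 i2 j : ℕ}, i1 < i2 → (i2, j) ∈ lam → T.1.entry i1 j < T.1.entry i2 j := by
      intro i1 i2 j hi h
      refine lt_of_le_of_ne (T.1.entry_mono hi.le le_rfl h (YoungDiagram.notMem_bot _))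
        fun he => hi.ne ?_
      -- There are as many distinct pairs (entry, column) as cells, so no entry repeats in a column.
      have h1 := T.1.degree_weight
      rw [T.2, hd, skewCells_bot] at h1
      have h2 := Finset.injOn_of_card_image_eq h1.symm
      have h3 := @h2 (i1, j) (lam.up_left_mem hi.le le_rfl h) (i2, j) h (by simp [he])
      exact congrArg Prod.fst h3
    have hT : content (⟨T.1.entry,
        fun hj h => T.1.entry_mono le_rfl hj.le h (YoungDiagram.notMem_bot _), hstrict,
        fun h => T.1.zeros (by simpa using h)⟩ : SemistandardYoungTableau lam) = d := by
      rw [← weight_toReversePlanePartition]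
      exact T.2
    ⟨_, hT⟩
  left_inv _ := rfl
  right_inv _ := rfl

section

variable (K : Type*) [CommRing K]

theorem coeff_schur_of_degree_eq {lam : YoungDiagram} {d : ℕ →₀ ℕ} (hd : d.degree = lam.card) :
    coeff d (schur K lam) = coeff d (dualGrothendieck K lam ⊥) :=
  congrArg Nat.cast (Nat.card_congr (tableauEquiv hd))

theorem coeff_schur_of_degree_ne {lam : YoungDiagram} {d : ℕ →₀ ℕ} (hd : d.degree ≠ lam.card) :
    coeff d (schur K lam) = 0 := by
  have : IsEmpty {T : SemistandardYoungTableau lam // content T = d} :=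
    ⟨fun T => hd (by rw [← T.2, degree_content])⟩
  change (Nat.card {T : SemistandardYoungTableau lam // content T = d} : K) = 0
  rw [Nat.card_of_isEmpty, Nat.cast_zero]

/-- Symmetry is inherited from `g_lam` in degree `lam.card`; no Bender–Knuth involution is needed.
-/
theorem schur_mem (lam : YoungDiagram) : schur K lam ∈ SymmFn K := by
  refine ⟨(mem_completed_iff _).2 fun σ d => ?_, lam.card, fun d hd =>
    coeff_schur_of_degree_ne K hd.ne'⟩
  have hdeg : (d.mapDomain σ).degree = d.degree := Finsupp.degree_mapDomain _ _
  by_cases hd : d.degree = lam.card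
  · rw [coeff_schur_of_degree_eq K hd, coeff_schur_of_degree_eq K (hdeg.trans hd)]
    exact (mem_completed_iff _).1 (dualGrothendieck_mem K lam ⊥ bot_le).1 σ d
  · rw [coeff_schur_of_degree_ne K hd, coeff_schur_of_degree_ne K (by rwa [hdeg])]

end

/-! ### Unitriangularity of the Schur functions -/

/-- The exponent vector whose entries are the row lengths of a Young diagram. -/
def rowVec (mu : YoungDiagram) : ℕ →₀ ℕ := ∑ c ∈ mu.cells, Finsupp.single c.1 1

theorem degree_rowVec (mu : YoungDiagram) : (rowVec mu).degree = mu.card := by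
  rw [rowVec, map_sum, YoungDiagram.card, Finset.card_eq_sum_ones]
  exact Finset.sum_congr rfl fun c _ => Finsupp.degree_single _ _

theorem rowVec_apply (mu : YoungDiagram) (i : ℕ) : rowVec mu i = mu.rowLen i := by
  rw [rowVec, YoungDiagram.rowLen_eq_card, YoungDiagram.row, Finset.card_filter,
    Finsupp.finsetSum_apply]
  simp only [Finsupp.single_apply]

theorem rowVec_injective : Function.Injective rowVec := by
  intro mu nu h
  refine SetLike.ext ?_
  rintro ⟨i, j⟩
  rw [YoungDiagram.mem_iff_lt_rowLen, YoungDiagram.mem_iff_lt_rowLen, ← rowVec_apply, h,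
    rowVec_apply]

/-- The sum of the row indices of the cells of a Young diagram. -/
def rowStat (mu : YoungDiagram) : ℕ := ∑ c ∈ mu.cells, c.1

theorem le_entry {lam : YoungDiagram} (T : SemistandardYoungTableau lam) {i j : ℕ}
    (h : (i, j) ∈ lam) : i ≤ T i j := by
  induction i with
  | zero => exact Nat.zero_le _
  | succ i ih =>
    exact (ih (lam.up_left_mem (Nat.le_succ i) le_rfl h)).trans_lt (T.col_strict (Nat.lt_succ_self i) h)

theorem rowStat_add_eq {lam mu : YoungDiagram} {T : SemistandardYoungTableau lam}
    (h : content T = rowVec mu) : ∑ c ∈ lam.cells, T c.1 c.2 = rowStat mu := by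
  -- Giving the variable `x i` weight `i` turns a content into the sum of the entries.
  have h1 := congrArg (Finsupp.weight (fun i : ℕ => i)) h
  simpa [content, rowVec, rowStat, Finsupp.weight_single] using h1

theorem entry_eq_of_rowStat_le {lam mu : YoungDiagram} {T : SemistandardYoungTableau lam}
    (h : content T = rowVec mu) (hle : rowStat mu ≤ rowStat lam) :
    ∀ c ∈ lam.cells, c.1 = T c.1 c.2 := by
  have h1 : ∀ c ∈ lam.cells, c.1 ≤ T c.1 c.2 := fun c hc => le_entry T hc
  refine (Finset.sum_eq_sum_iff_of_le h1).1 (le_antisymm (Finset.sum_le_sum h1) ?_)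
  rw [rowStat_add_eq h]
  exact hle

/-- Entries in row `i` are at least `i`, so the entry sum, which is `rowStat mu`, is at least
`rowStat lam`. Equality forces every entry to be its row index, and the content is then `rowVec
lam`. Thus `rowStat` replaces the dominance order in the triangularity argument. -/
theorem eq_of_rowStat_le {lam mu : YoungDiagram} {T : SemistandardYoungTableau lam}
    (h : content T = rowVec mu) (hle : rowStat mu ≤ rowStat lam) : lam = mu := by
  refine rowVec_injective (h ▸ ?_)
  exact Finset.sum_congr rfl fun c hc => by rw [← entry_eq_of_rowStat_le h hle c hc]

section

variable (K : Type*) [CommRing K]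

theorem coeff_rowVec_schur_self (mu : YoungDiagram) : coeff (rowVec mu) (schur K mu) = 1 := by
  have h0 : content (SemistandardYoungTableau.highestWeight mu) = rowVec mu :=
    Finset.sum_congr rfl fun c hc => by
      rw [SemistandardYoungTableau.highestWeight_apply, if_pos (YoungDiagram.mem_cells _ |>.1 hc)]
  have : Unique {T : SemistandardYoungTableau mu // content T = rowVec mu} := by
    refine ⟨⟨⟨_, h0⟩⟩, fun T => Subtype.ext (SemistandardYoungTableau.ext fun i j => ?_)⟩
    change T.1 i j = SemistandardYoungTableau.highestWeight mu i j
    rw [SemistandardYoungTableau.highestWeight_apply]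
    split_ifs with h
    · exact (entry_eq_of_rowStat_le T.2 le_rfl (i, j) h).symm
    · exact T.1.zeros h
  change (Nat.card {T : SemistandardYoungTableau mu // content T = rowVec mu} : K) = 1
  rw [Nat.card_unique, Nat.cast_one]

variable {K}

theorem exists_tableau_of_coeff_ne_zero {lam : YoungDiagram} {d : ℕ →₀ ℕ}
    (h : coeff d (schur K lam) ≠ 0) : ∃ T : SemistandardYoungTableau lam, content T = d := by
  by_contra! h1
  have : IsEmpty {T : SemistandardYoungTableau lam // content T = d} := ⟨fun T => h1 T.1 T.2⟩
  refine h ?_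
  change (Nat.card {T : SemistandardYoungTableau lam // content T = d} : K) = 0
  rw [Nat.card_of_isEmpty, Nat.cast_zero]

theorem coeff_rowVec_schur_eq_zero {lam mu : YoungDiagram} (hne : lam ≠ mu)
    (h : rowStat mu ≤ rowStat lam) : coeff (rowVec mu) (schur K lam) = 0 := by
  by_contra h1
  obtain ⟨T, hT⟩ := exists_tableau_of_coeff_ne_zero h1
  exact hne (eq_of_rowStat_le hT h)

end

/-! ### Rearranging exponent vectors into partitions -/

theorem exists_rowVec_eq_of_antitone {d : ℕ →₀ ℕ} (h : Antitone d) : ∃ mu, rowVec mu = d := by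
  classical
  obtain ⟨n, hn⟩ := exists_forall_ge_eq_zero d
  let mu : YoungDiagram :=
    { cells := (Finset.range n ×ˢ Finset.range (d 0)).filter fun c => c.2 < d c.1
      isLowerSet := by
        rintro ⟨a, b⟩ ⟨c, e⟩ hle hc
        obtain ⟨h1, h2⟩ : c ≤ a ∧ e ≤ b := hle
        simp only [Finset.coe_filter, Finset.mem_product, Finset.mem_range, Set.mem_ofPred_eq]
          at hc ⊢
        have := h h1
        omega }
  refine ⟨mu, Finsupp.ext fun i => ?_⟩
  have hmem : ∀ i j, (i, j) ∈ mu ↔ j < d i := by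
    intro i j
    rw [← YoungDiagram.mem_cells]
    simp only [mu, Finset.mem_filter, Finset.mem_product, Finset.mem_range, and_iff_right_iff_imp]
    intro h1
    refine ⟨not_le.1 fun h2 => ?_, h1.trans_le (h (Nat.zero_le i))⟩
    rw [hn i h2] at h1
    exact Nat.not_lt_zero _ h1
  rw [rowVec_apply]
  refine le_antisymm (le_of_not_gt fun h1 => ?_) (le_of_not_gt fun h1 => ?_)
  · exact lt_irrefl _ ((hmem _ _).1 (YoungDiagram.mem_iff_lt_rowLen.2 h1))
  · exact lt_irrefl _ (YoungDiagram.mem_iff_lt_rowLen.1 ((hmem _ _).2 h1))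

theorem exists_mapDomain_eq_rowVec (d : ℕ →₀ ℕ) :
    ∃ (σ : Equiv.Perm ℕ) (mu : YoungDiagram), d.mapDomain σ = rowVec mu := by
  obtain ⟨n, hn⟩ := exists_forall_ge_eq_zero d
  -- The order dual makes the sorted exponents weakly decreasing; the sorting permutation is
  -- extended by the identity beyond `n`, where `d` vanishes.
  let f : Fin n → ℕᵒᵈ := fun i => OrderDual.toDual (d i)
  let τ : Equiv.Perm ℕ := (Tuple.sort f).extendDomain Fin.equivSubtype
  have hτ : ∀ (i : ℕ) (hi : i < n), τ i = Tuple.sort f ⟨i, hi⟩ := fun i hi =>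
    Equiv.Perm.extendDomain_apply_subtype (Tuple.sort f) Fin.equivSubtype hi
  have hτ' : ∀ i, n ≤ i → τ i = i := fun i hi =>
    Equiv.Perm.extendDomain_apply_not_subtype (Tuple.sort f) Fin.equivSubtype (not_lt.2 hi)
  have hd : ∀ i, (d.mapDomain τ.symm) i = d (τ i) := by
    intro i
    conv_lhs => rw [← τ.symm_apply_apply i]
    exact Finsupp.mapDomain_apply τ.symm.injective _ _
  obtain ⟨mu, hmu⟩ := exists_rowVec_eq_of_antitone (d := d.mapDomain τ.symm) (by
    intro i j hij
    rw [hd, hd]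
    rcases lt_or_ge j n with hj | hj
    · rw [hτ i (by omega), hτ j hj]
      exact Tuple.monotone_sort f (show (⟨i, by omega⟩ : Fin n) ≤ ⟨j, hj⟩ from hij)
    · rw [hτ' j hj, hn j hj]
      exact Nat.zero_le _)
  exact ⟨τ.symm, mu, hmu.symm⟩

theorem completed_ext {K : Type*} [CommRing K] {F G : MvPowerSeries ℕ K} (hF : F ∈ Completed K)
    (hG : G ∈ Completed K) (h : ∀ mu, coeff (rowVec mu) F = coeff (rowVec mu) G) : F = G := by
  ext d
  obtain ⟨σ, mu, hd⟩ := exists_mapDomain_eq_rowVec d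
  rw [← (mem_completed_iff F).1 hF σ d, ← (mem_completed_iff G).1 hG σ d, hd, h]

/-! ### Expansion into Schur functions -/

theorem finite_card_eq (n : ℕ) : {lam : YoungDiagram | lam.card = n}.Finite := by
  refine Set.Finite.of_finite_image (f := YoungDiagram.cells)
    (((Finset.range n ×ˢ Finset.range n).powerset.finite_toSet).subset ?_)
    fun x _ y _ h => YoungDiagram.ext h
  rintro _ ⟨lam, rfl, rfl⟩
  refine Finset.mem_coe.2 (Finset.mem_powerset.2 ?_)
  rintro ⟨i, j⟩ hc
  rw [YoungDiagram.mem_cells] at hc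
  have h1 : lam.colLen j ≤ lam.card := by
    rw [YoungDiagram.colLen_eq_card]
    exact Finset.card_filter_le _ _
  have h2 : lam.rowLen i ≤ lam.card := by
    rw [YoungDiagram.rowLen_eq_card]
    exact Finset.card_filter_le _ _
  exact Finset.mem_product.2 ⟨Finset.mem_range.2 ((YoungDiagram.mem_iff_lt_colLen.1 hc).trans_le h1),
    Finset.mem_range.2 ((YoungDiagram.mem_iff_lt_rowLen.1 hc).trans_le h2)⟩

/-- The Young diagrams with `n` cells. -/
def diagrams (n : ℕ) : Finset YoungDiagram := (finite_card_eq n).toFinset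

@[simp]
theorem mem_diagrams {n : ℕ} {lam : YoungDiagram} : lam ∈ diagrams n ↔ lam.card = n := by
  simp [diagrams]

section

variable {K : Type*} [CommRing K]

theorem finsum_schur (A : YoungDiagram → K) (d : ℕ →₀ ℕ) :
    ∑ᶠ lam, A lam * coeff d (schur K lam) =
      ∑ lam ∈ diagrams d.degree, A lam * coeff d (schur K lam) := by
  refine finsum_eq_sum_of_support_subset _ fun lam h => ?_
  rw [Finset.mem_coe, mem_diagrams]
  by_contra h1
  refine h ?_
  beta_reduce
  rw [coeff_schur_of_degree_ne K (Ne.symm h1), mul_zero]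

/-- The (possibly infinite) linear combination of Schur functions with given coefficients. -/
def schurSum (A : YoungDiagram → K) : MvPowerSeries ℕ K :=
  fun d => ∑ᶠ lam, A lam * coeff d (schur K lam)

theorem coeff_schurSum (A : YoungDiagram → K) (d : ℕ →₀ ℕ) :
    coeff d (schurSum A) = ∑ lam ∈ diagrams d.degree, A lam * coeff d (schur K lam) :=
  finsum_schur A d

theorem isSchurExpansion_iff {F : MvPowerSeries ℕ K} {A : YoungDiagram → K} :
    IsSchurExpansion F A ↔ F = schurSum A :=
  MvPowerSeries.ext_iff.symm

theorem schurSum_mem (A : YoungDiagram → K) : schurSum A ∈ Completed K := by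
  rw [mem_completed_iff]
  intro σ d
  rw [coeff_schurSum, coeff_schurSum, Finsupp.degree_mapDomain]
  refine Finset.sum_congr rfl fun lam _ => ?_
  rw [(mem_completed_iff _).1 (schur_mem K lam).1 σ d]

/-- The system for the Schur coefficients is unitriangular, so it has a unique solution over any
commutative ring. -/
theorem coeff_rowVec_schurSum (A : YoungDiagram → K) (mu : YoungDiagram) :
    coeff (rowVec mu) (schurSum A) = A mu +
      ∑ lam ∈ diagrams mu.card with rowStat lam < rowStat mu,
        A lam * coeff (rowVec mu) (schur K lam) := by
  classical
  rw [coeff_schurSum, degree_rowVec, Finset.sum_filter,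
    ← Finset.add_sum_erase _ _ (mem_diagrams.2 rfl : mu ∈ diagrams mu.card),
    ← Finset.add_sum_erase (diagrams mu.card) (fun lam => if rowStat lam < rowStat mu then _ else _)
      (mem_diagrams.2 rfl : mu ∈ diagrams mu.card),
    coeff_rowVec_schur_self, mul_one, if_neg (lt_irrefl _), zero_add]
  congr 1
  refine Finset.sum_congr rfl fun lam hlam => ?_
  split_ifs with h
  · rfl
  · rw [coeff_rowVec_schur_eq_zero (Finset.ne_of_mem_erase hlam) (not_lt.1 h), mul_zero]

/-- The Schur coefficients of a symmetric power series, by recursion on `rowStat`. -/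
def schurRec (F : MvPowerSeries ℕ K) (mu : YoungDiagram) : K :=
  coeff (rowVec mu) F -
    ∑ lam ∈ ((diagrams mu.card).filter fun lam => rowStat lam < rowStat mu).attach,
      schurRec F lam.1 * coeff (rowVec mu) (schur K lam.1)
termination_by rowStat mu
decreasing_by exact (Finset.mem_filter.1 lam.2).2

theorem schurSum_schurRec {F : MvPowerSeries ℕ K} (hF : F ∈ Completed K) :
    schurSum (schurRec F) = F := by
  refine completed_ext (schurSum_mem _) hF fun mu => ?_
  rw [coeff_rowVec_schurSum, schurRec,
    Finset.sum_attach _ (fun lam => schurRec F lam * coeff (rowVec mu) (schur K lam)),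
    sub_add_cancel]

theorem schurSum_injective : Function.Injective (schurSum (K := K)) := by
  intro A B h
  have key : ∀ n mu, rowStat mu = n → A mu = B mu := by
    intro n
    induction n using Nat.strong_induction_on with
    | _ n ih =>
      rintro mu rfl
      have h1 := congrArg (coeff (rowVec mu)) h
      rw [coeff_rowVec_schurSum, coeff_rowVec_schurSum, Finset.sum_congr rfl
        (fun lam hlam => by rw [ih _ (Finset.mem_filter.1 hlam).2 lam rfl])] at h1
      exact add_right_cancel h1
  exact funext fun mu => key _ mu rfl

theorem schurSum_schurCoeff (F : Completed K) : schurSum (schurCoeff F) = F := by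
  have h : ∃ A, IsSchurExpansion (F : MvPowerSeries ℕ K) A :=
    ⟨_, isSchurExpansion_iff.2 (schurSum_schurRec F.2).symm⟩
  rw [schurCoeff, dif_pos h]
  exact (isSchurExpansion_iff.1 h.choose_spec).symm

theorem schurCoeff_eq {F : Completed K} {A : YoungDiagram → K} (h : schurSum A = F) :
    schurCoeff F = A :=
  schurSum_injective ((schurSum_schurCoeff F).trans h.symm)

/-- Discarding the coefficients of diagrams with more than `N` cells gives another Schur expansion
of `f`, and expansions are unique. -/
theorem schurCoeff_eq_zero {f : MvPowerSeries ℕ K} (hf : f ∈ Completed K) {N : ℕ}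
    (hN : ∀ d : ℕ →₀ ℕ, N < d.degree → coeff d f = 0) {lam : YoungDiagram} (h : N < lam.card) :
    schurCoeff ⟨f, hf⟩ lam = 0 := by
  have h1 : schurCoeff ⟨f, hf⟩ = fun lam => if lam.card ≤ N then schurCoeff ⟨f, hf⟩ lam else 0 := by
    refine schurCoeff_eq (MvPowerSeries.ext fun d => ?_)
    have h2 := congrArg (coeff d) (schurSum_schurCoeff ⟨f, hf⟩)
    rw [coeff_schurSum] at h2 ⊢
    by_cases hd : d.degree ≤ N
    · rw [← h2]
      refine Finset.sum_congr rfl fun lam hlam => ?_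
      rw [if_pos ((mem_diagrams.1 hlam).trans_le hd)]
    · rw [hN d (not_le.1 hd)]
      refine Finset.sum_eq_zero fun lam hlam => ?_
      rw [if_neg (by rwa [mem_diagrams.1 hlam]), zero_mul]
  rw [h1]
  exact if_neg (not_le.2 h)

end

/-! ### Adjoining a variable and setting it equal to one -/

section PlusOne

variable {K : Type*} [CommRing K]

/-- A variable not occurring in the monomial `d`. -/
def fresh (d : ℕ →₀ ℕ) : ℕ := (Infinite.exists_notMem_finset d.support).choose

theorem apply_fresh (d : ℕ →₀ ℕ) : d (fresh d) = 0 :=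
  Finsupp.notMem_support_iff.1 (Infinite.exists_notMem_finset d.support).choose_spec

/-- The transposition of two variables absent from `d` fixes `d`. Hence any unused variable can play
the role of the adjoined one. -/
theorem coeff_add_single_eq {F : MvPowerSeries ℕ K} (hF : F ∈ Completed K) {d : ℕ →₀ ℕ} {m n : ℕ}
    (hm : d m = 0) (hn : d n = 0) (k : ℕ) :
    coeff (d + Finsupp.single m k) F = coeff (d + Finsupp.single n k) F := by
  have h : d.mapDomain (Equiv.swap m n) = d := by
    ext i
    conv_lhs => rw [← Equiv.swap_apply_self m n i]
    rw [Finsupp.mapDomain_apply (Equiv.swap m n).injective]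
    rcases eq_or_ne i m with rfl | h1
    · rw [Equiv.swap_apply_left, hm, hn]
    · rcases eq_or_ne i n with rfl | h2
      · rw [Equiv.swap_apply_right, hm, hn]
      · rw [Equiv.swap_apply_of_ne_of_ne h1 h2]
  rw [← (mem_completed_iff F).1 hF (Equiv.swap m n) (d + Finsupp.single m k),
    Finsupp.mapDomain_add, h, Finsupp.mapDomain_single, Equiv.swap_apply_left]

/-- The power series `f` has no terms of degree `m` or more. -/
def DegreeLT (f : MvPowerSeries ℕ K) (m : ℕ) : Prop :=
  ∀ d : ℕ →₀ ℕ, m ≤ d.degree → coeff d f = 0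

theorem DegreeLT.mono {f : MvPowerSeries ℕ K} {m n : ℕ} (h : DegreeLT f m) (hmn : m ≤ n) :
    DegreeLT f n :=
  fun d hd => h d (hmn.trans hd)

theorem exists_degreeLT (f : SymmFn K) : ∃ m, DegreeLT (f : MvPowerSeries ℕ K) m := by
  obtain ⟨N, hN⟩ := f.2.2
  exact ⟨N + 1, fun d hd => hN d hd⟩

theorem degree_add_single (d : ℕ →₀ ℕ) (n k : ℕ) :
    (d + Finsupp.single n k).degree = d.degree + k := by
  rw [map_add, Finsupp.degree_single]

/-- The series obtained from a symmetric function `f` by adjoining a new variable and setting it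
equal to `1`. -/
def plusOne (f : MvPowerSeries ℕ K) : MvPowerSeries ℕ K :=
  fun d => ∑ᶠ k : ℕ, coeff (d + Finsupp.single (fresh d) k) f

theorem coeff_plusOne {f : MvPowerSeries ℕ K} (hf : f ∈ Completed K) {m : ℕ} (hm : DegreeLT f m)
    {d : ℕ →₀ ℕ} {n : ℕ} (hn : d n = 0) :
    coeff d (plusOne f) = ∑ k ∈ Finset.range m, coeff (d + Finsupp.single n k) f := by
  have h : coeff d (plusOne f) = ∑ᶠ k : ℕ, coeff (d + Finsupp.single n k) f :=
    finsum_congr fun k => coeff_add_single_eq hf (apply_fresh d) hn k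
  rw [h]
  refine finsum_eq_sum_of_support_subset _ fun k hk => ?_
  rw [Finset.mem_coe, Finset.mem_range]
  by_contra! h1
  exact hk (hm _ (by rw [degree_add_single]; omega))

theorem plusOne_degreeLT {f : MvPowerSeries ℕ K} (hf : f ∈ Completed K) {m : ℕ}
    (hm : DegreeLT f m) : DegreeLT (plusOne f) m := by
  intro d hd
  rw [coeff_plusOne hf hm (apply_fresh d)]
  exact Finset.sum_eq_zero fun k _ => hm _ (by rw [degree_add_single]; omega)

/-- The term `k = 0` recovers `f`, and the others read coefficients of strictly higher degree. This
lowering of degree gives bijectivity below. -/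
theorem plusOne_sub_degreeLT {f : MvPowerSeries ℕ K} (hf : f ∈ Completed K) {m : ℕ}
    (hm : DegreeLT f (m + 1)) : DegreeLT (plusOne f - f) m := by
  intro d hd
  rw [map_sub, coeff_plusOne hf hm (apply_fresh d), Finset.sum_range_succ', Finsupp.single_zero,
    add_zero, add_sub_cancel_right]
  exact Finset.sum_eq_zero fun k _ => hm _ (by rw [degree_add_single]; omega)

theorem plusOne_mem (f : SymmFn K) : plusOne (f : MvPowerSeries ℕ K) ∈ SymmFn K := by
  obtain ⟨m, hm⟩ := exists_degreeLT f
  refine ⟨(mem_completed_iff _).2 fun σ d => ?_, m, fun d hd => plusOne_degreeLT f.2.1 hm d hd.le⟩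
  have h : (d.mapDomain σ) (σ (fresh d)) = 0 := by
    rw [Finsupp.mapDomain_apply σ.injective, apply_fresh]
  rw [coeff_plusOne f.2.1 hm h, coeff_plusOne f.2.1 hm (apply_fresh d)]
  refine Finset.sum_congr rfl fun k _ => ?_
  rw [← (mem_completed_iff _).1 f.2.1 σ (d + Finsupp.single (fresh d) k), Finsupp.mapDomain_add, Finsupp.mapDomain_single]

/-- Factoring the monomial amounts to factoring its part away from the variable `n` and its power of
that variable independently. -/
theorem sum_antidiagonal_add_single {M : Type*} [AddCommMonoid M] {d : ℕ →₀ ℕ} {n : ℕ}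
    (hn : d n = 0) (k : ℕ) (φ : (ℕ →₀ ℕ) → (ℕ →₀ ℕ) → M) :
    ∑ p ∈ Finset.HasAntidiagonal.antidiagonal (d + Finsupp.single n k), φ p.1 p.2 =
      ∑ p ∈ Finset.HasAntidiagonal.antidiagonal d, ∑ q ∈ Finset.HasAntidiagonal.antidiagonal k,
        φ (p.1 + Finsupp.single n q.1) (p.2 + Finsupp.single n q.2) := by
  rw [← Finset.sum_product']
  have hz : ∀ {u v : ℕ →₀ ℕ}, u + v = d → u n = 0 ∧ v n = 0 := by
    rintro u v rfl
    simpa using hn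
  refine Finset.sum_bij' (fun p _ => ((p.1.erase n, p.2.erase n), (p.1 n, p.2 n)))
    (fun p _ => (p.1.1 + Finsupp.single n p.2.1, p.1.2 + Finsupp.single n p.2.2)) ?_ ?_ ?_ ?_ ?_
  · rintro ⟨u, v⟩ h
    rw [Finset.HasAntidiagonal.mem_antidiagonal] at h
    simp only [Finset.mem_product, Finset.HasAntidiagonal.mem_antidiagonal]
    constructor
    · rw [← Finsupp.erase_add, h, Finsupp.erase_add, Finsupp.erase_single, add_zero]
      exact Finsupp.erase_of_notMem_support (by simpa using hn)
    · have := DFunLike.congr_fun h n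
      simpa [hn] using this
  · rintro ⟨⟨u, v⟩, ⟨a, b⟩⟩ h
    simp only [Finset.mem_product, Finset.HasAntidiagonal.mem_antidiagonal] at h ⊢
    rw [← h.1, ← h.2, Finsupp.single_add]
    abel
  · rintro ⟨u, v⟩ h
    simp only [Finsupp.erase_add_single]
  · rintro ⟨⟨u, v⟩, ⟨a, b⟩⟩ h
    simp only [Finset.mem_product, Finset.HasAntidiagonal.mem_antidiagonal] at h
    obtain ⟨h1, h2⟩ := hz h.1
    have e : ∀ {w : ℕ →₀ ℕ} (c : ℕ), w n = 0 → (w + Finsupp.single n c).erase n = w := by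
      intro w c hw
      rw [Finsupp.erase_add, Finsupp.erase_single, add_zero]
      exact Finsupp.erase_of_notMem_support (by simpa using hw)
    simp [e _ h1, e _ h2, h1, h2]
  · rintro ⟨u, v⟩ h
    simp only [Finsupp.erase_add_single]

/-- The terms of `f` with the exponents of `d` outside the variable `n`, as a polynomial in the
variable `n`. -/
def slice (f : MvPowerSeries ℕ K) (m n : ℕ) (d : ℕ →₀ ℕ) : Polynomial K :=
  ∑ k ∈ Finset.range m, Polynomial.monomial k (coeff (d + Finsupp.single n k) f)

theorem coeff_slice {f : MvPowerSeries ℕ K} {m : ℕ} (hm : DegreeLT f m) (n : ℕ) (d : ℕ →₀ ℕ)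
    (k : ℕ) : (slice f m n d).coeff k = coeff (d + Finsupp.single n k) f := by
  simp only [slice, Polynomial.finsetSum_coeff, Polynomial.coeff_monomial, Finset.sum_ite_eq',
    Finset.mem_range, ite_eq_left_iff, not_lt]
  intro h
  rw [hm _ (by rw [degree_add_single]; omega)]

theorem eval_slice {f : MvPowerSeries ℕ K} (hf : f ∈ Completed K) {m : ℕ} (hm : DegreeLT f m)
    {d : ℕ →₀ ℕ} {n : ℕ} (hn : d n = 0) : (slice f m n d).eval 1 = coeff d (plusOne f) := by
  rw [coeff_plusOne hf hm hn, slice, Polynomial.eval_finsetSum]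
  simp

/-- Slices in an unused variable multiply by convolution over the factorisations of `d`, and
evaluation of polynomials at `1` is multiplicative. -/
theorem plusOne_mul (f g : SymmFn K) :
    plusOne (f * g : MvPowerSeries ℕ K) = plusOne (f : MvPowerSeries ℕ K) * plusOne g := by
  classical
  obtain ⟨a, ha⟩ := exists_degreeLT f
  obtain ⟨b, hb⟩ := exists_degreeLT g
  obtain ⟨c, hc⟩ : ∃ c, DegreeLT (f * g : MvPowerSeries ℕ K) c := exists_degreeLT (f * g)
  have hfg : (f * g : MvPowerSeries ℕ K) ∈ Completed K := (f * g).2.1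
  ext d
  have hn := apply_fresh d
  have key : slice (f * g : MvPowerSeries ℕ K) c (fresh d) d =
      ∑ p ∈ Finset.HasAntidiagonal.antidiagonal d, slice f a (fresh d) p.1 * slice g b (fresh d) p.2 := by
    ext k
    rw [coeff_slice hc, coeff_mul, sum_antidiagonal_add_single hn k
      (fun u v => coeff u (f : MvPowerSeries ℕ K) * coeff v (g : MvPowerSeries ℕ K)),
      Polynomial.finsetSum_coeff]
    refine Finset.sum_congr rfl fun p _ => ?_
    rw [Polynomial.coeff_mul]
    exact Finset.sum_congr rfl fun q _ => by rw [coeff_slice ha, coeff_slice hb]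
  rw [← eval_slice hfg hc hn, key, Polynomial.eval_finsetSum, coeff_mul]
  refine Finset.sum_congr rfl fun p hp => ?_
  have hp' : p.1 (fresh d) = 0 ∧ p.2 (fresh d) = 0 := by
    have := DFunLike.congr_fun (Finset.HasAntidiagonal.mem_antidiagonal.1 hp) (fresh d)
    rw [Finsupp.add_apply, hn] at this
    omega
  rw [Polynomial.eval_mul, eval_slice f.2.1 ha hp'.1, eval_slice g.2.1 hb hp'.2]

/-- Adjoining a variable and setting it equal to `1`, as a linear map. -/
def plusOneLin : SymmFn K →ₗ[K] SymmFn K where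
  toFun f := ⟨plusOne f, plusOne_mem f⟩
  map_add' f g := by
    obtain ⟨a, ha⟩ := exists_degreeLT f
    obtain ⟨b, hb⟩ := exists_degreeLT g
    obtain ⟨c, hc⟩ := exists_degreeLT (f + g)
    refine Subtype.ext (MvPowerSeries.ext fun d => ?_)
    change coeff d (plusOne (f + g : SymmFn K)) = coeff d (plusOne (f : MvPowerSeries ℕ K) + plusOne (g : MvPowerSeries ℕ K))
    rw [map_add, coeff_plusOne (f + g).2.1 (hc.mono (le_max_left c (max a b))) (apply_fresh d),
      coeff_plusOne f.2.1 (ha.mono (show a ≤ max c (max a b) by simp)) (apply_fresh d),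
      coeff_plusOne g.2.1 (hb.mono (show b ≤ max c (max a b) by simp)) (apply_fresh d),
      ← Finset.sum_add_distrib]
    exact Finset.sum_congr rfl fun k _ => map_add _ _ _
  map_smul' r f := by
    obtain ⟨a, ha⟩ := exists_degreeLT f
    obtain ⟨c, hc⟩ := exists_degreeLT (r • f)
    refine Subtype.ext (MvPowerSeries.ext fun d => ?_)
    change coeff d (plusOne (r • f : SymmFn K)) = coeff d (r • plusOne (f : MvPowerSeries ℕ K))
    rw [map_smul, coeff_plusOne (r • f).2.1 (hc.mono (le_max_left c a)) (apply_fresh d),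
      coeff_plusOne f.2.1 (ha.mono (le_max_right c a)) (apply_fresh d), Finset.smul_sum]
    exact Finset.sum_congr rfl fun k _ => map_smul _ _ _

@[simp]
theorem coe_plusOneLin (f : SymmFn K) : (plusOneLin f : MvPowerSeries ℕ K) = plusOne f := rfl

theorem plusOneLin_one : plusOneLin (1 : SymmFn K) = 1 := by
  classical
  refine Subtype.ext (MvPowerSeries.ext fun d => ?_)
  have h : DegreeLT ((1 : SymmFn K) : MvPowerSeries ℕ K) 1 := by
    intro d hd
    change coeff d (1 : MvPowerSeries ℕ K) = 0
    rw [coeff_one, if_neg]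
    rintro rfl
    simp at hd
  rw [coe_plusOneLin, coeff_plusOne (1 : SymmFn K).2.1 h (apply_fresh d)]
  simp

/-- Adjoining a variable and setting it equal to `1`, as an algebra homomorphism. -/
def plusOneHom : SymmFn K →ₐ[K] SymmFn K :=
  AlgHom.ofLinearMap plusOneLin plusOneLin_one fun f g => Subtype.ext (plusOne_mul f g)

theorem plusOneHom_injective : Function.Injective (plusOneHom (K := K)) := by
  rw [injective_iff_map_eq_zero]
  intro f hf
  have hf' : plusOne (f : MvPowerSeries ℕ K) = 0 := congrArg Subtype.val hf
  have key : ∀ m, DegreeLT (f : MvPowerSeries ℕ K) m → DegreeLT (f : MvPowerSeries ℕ K) 0 := by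
    intro m
    induction m with
    | zero => exact id
    | succ m ih =>
      intro h
      refine ih fun d hd => ?_
      have := plusOne_sub_degreeLT f.2.1 h d hd
      rwa [hf', zero_sub, map_neg, neg_eq_zero] at this
  obtain ⟨m, hm⟩ := exists_degreeLT f
  exact Subtype.ext (MvPowerSeries.ext fun d => key m hm d (Nat.zero_le _))

theorem plusOneHom_surjective : Function.Surjective (plusOneHom (K := K)) := by
  have key : ∀ (m : ℕ) (f : SymmFn K), DegreeLT (f : MvPowerSeries ℕ K) m →
      ∃ g, plusOneHom g = f := by
    intro m
    induction m with
    | zero =>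
      intro f hf
      refine ⟨0, ?_⟩
      rw [map_zero]
      exact Subtype.ext (MvPowerSeries.ext fun d => (hf d (Nat.zero_le _)).symm)
    | succ m ih =>
      intro f hf
      -- The error made by taking `f` as its own preimage has lower degree, hence has a preimage
      -- `g`; subtracting it corrects the guess.
      obtain ⟨g, hg⟩ := ih (plusOneHom f - f) (plusOne_sub_degreeLT f.2.1 hf)
      exact ⟨f - g, by rw [map_sub, hg, sub_sub_cancel]⟩
  intro f
  obtain ⟨m, hm⟩ := exists_degreeLT f
  exact key m f hm

/-- Adjoining a variable and setting it equal to `1`, as an algebra automorphism. -/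
def plusOneEquiv : SymmFn K ≃ₐ[K] SymmFn K :=
  AlgEquiv.ofBijective plusOneHom ⟨plusOneHom_injective, plusOneHom_surjective⟩

@[simp]
theorem coe_plusOneEquiv (f : SymmFn K) : (plusOneEquiv f : MvPowerSeries ℕ K) = plusOne f := rfl

end PlusOne

/-! ### The effect on dual stable Grothendieck polynomials and Schur functions -/

section Branching

variable (K : Type*) [CommRing K]

theorem numCols_le_card (lam mu : YoungDiagram) : numCols lam mu ≤ (skewCells lam mu).card :=
  Finset.card_image_le

theorem card_skewCells_add {lam mu : YoungDiagram} (h : mu ≤ lam) :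
    (skewCells lam mu).card + mu.card = lam.card :=
  Finset.card_sdiff_add_card_eq_card (YoungDiagram.cells_subset_iff.2 h)

theorem card_skewCells_mono {lam mu nu nu' : YoungDiagram} (h : mu ≤ nu) (h' : nu' ≤ lam) :
    (skewCells nu' nu).card ≤ (skewCells lam mu).card :=
  Finset.card_le_card (Finset.sdiff_subset_sdiff (YoungDiagram.cells_subset_iff.2 h')
    (YoungDiagram.cells_subset_iff.2 h))

/-- The dual stable Grothendieck polynomial as an element of the ring of symmetric functions. -/
def dualG (lam mu : YoungDiagram) (h : mu ≤ lam) : SymmFn K :=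
  ⟨dualGrothendieck K lam mu, dualGrothendieck_mem K lam mu h⟩

theorem degreeLT_dualGrothendieck (lam mu : YoungDiagram) :
    DegreeLT (dualGrothendieck K lam mu) ((skewCells lam mu).card + 1) :=
  fun _ hd => coeff_dualGrothendieck_of_card_lt K hd

theorem coeff_plusOne_dualGrothendieck {lam mu : YoungDiagram} (h : mu ≤ lam) (d : ℕ →₀ ℕ) :
    coeff d (plusOne (dualGrothendieck K lam mu)) =
      ∑ k ∈ Finset.range ((skewCells lam mu).card + 1),
        colProd K (d + Finsupp.single (fresh d) k) mu lam := by
  rw [coeff_plusOne (dualGrothendieck_mem K lam mu h).1 (degreeLT_dualGrothendieck K lam mu)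
    (apply_fresh d)]
  exact Finset.sum_congr rfl fun k _ => coeff_dualGrothendieck K h _

/-- The extra operator is put at the right end of the product, as if the new variable were the
largest. Summed over all exponents, it marks each `nu ≤ lam` exactly once. -/
theorem plusOne_dualGrothendieck_right {lam mu : YoungDiagram} (h : mu ≤ lam) :
    plusOne (dualGrothendieck K lam mu) = ∑ nu ∈ Finset.Icc mu lam, dualGrothendieck K nu mu := by
  classical
  ext d
  rw [coeff_plusOne_dualGrothendieck K h, map_sum]
  simp_rw [colProd_add_single K (apply_fresh d), IncidenceAlgebra.mul_apply]
  rw [Finset.sum_comm]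
  refine Finset.sum_congr rfl fun nu hnu => ?_
  rw [Finset.mem_Icc] at hnu
  simp_rw [colOp_apply K hnu.2, mul_ite, mul_one, mul_zero]
  rw [Finset.sum_ite_eq, if_pos, coeff_dualGrothendieck K hnu.1]
  have h1 := numCols_le_card lam nu
  have h2 := card_skewCells_mono hnu.1 (le_refl lam)
  exact Finset.mem_range.2 (by omega)

/-- By commutation the same operator may stand at the left end, as if the new variable were the
smallest. -/
theorem plusOne_dualGrothendieck_left {lam mu : YoungDiagram} (h : mu ≤ lam) :
    plusOne (dualGrothendieck K lam mu) = ∑ nu ∈ Finset.Icc mu lam, dualGrothendieck K lam nu := by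
  classical
  ext d
  rw [coeff_plusOne_dualGrothendieck K h, map_sum]
  simp_rw [colProd_add_single' K (apply_fresh d), IncidenceAlgebra.mul_apply]
  rw [Finset.sum_comm]
  refine Finset.sum_congr rfl fun nu hnu => ?_
  rw [Finset.mem_Icc] at hnu
  simp_rw [colOp_apply K hnu.1, ite_mul, one_mul, zero_mul]
  rw [Finset.sum_ite_eq, if_pos, coeff_dualGrothendieck K hnu.2]
  have h1 := numCols_le_card nu mu
  have h2 := card_skewCells_mono (le_refl mu) hnu.2
  exact Finset.mem_range.2 (by omega)

/-- The branching rule for Schur functions: the sum is over horizontal strips. -/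
theorem plusOne_schur (lam : YoungDiagram) :
    plusOne (schur K lam) =
      ∑ nu ∈ Finset.Icc ⊥ lam with numCols lam nu + nu.card = lam.card, schur K nu := by
  classical
  have hdeg : DegreeLT (schur K lam) (lam.card + 1) := fun d hd =>
    coeff_schur_of_degree_ne K (by omega)
  ext d
  rw [coeff_plusOne (schur_mem K lam).1 hdeg (apply_fresh d), map_sum]
  rcases Nat.lt_or_ge lam.card d.degree with hd | hd
  · rw [Finset.sum_eq_zero, Finset.sum_eq_zero]
    · intro nu hnu
      have h1 := (Finset.mem_filter.1 hnu).2
      exact coeff_schur_of_degree_ne K (by omega)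
    · intro k _
      exact coeff_schur_of_degree_ne K (by rw [degree_add_single]; omega)
  -- Since `s_lam` is homogeneous, only this exponent of the adjoined variable contributes, and
  -- there `s_lam` agrees with `g_lam`.
  · rw [Finset.sum_eq_single (lam.card - d.degree)]
    · rw [coeff_schur_of_degree_eq K (by rw [degree_add_single]; omega),
        coeff_dualGrothendieck K bot_le, colProd_add_single K (apply_fresh d),
        IncidenceAlgebra.mul_apply, Finset.sum_filter]
      refine Finset.sum_congr rfl fun nu hnu => ?_
      rw [Finset.mem_Icc] at hnu
      rw [colOp_apply K hnu.2, ← coeff_dualGrothendieck K hnu.1, mul_ite, mul_one, mul_zero]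
      have h1 := numCols_le_card lam nu
      have h2 := card_skewCells_add hnu.2
      -- If `nu` is too small, `g_nu` has no term in this degree; if it is too large, `lam / nu` has
      -- too few cells for the required number of columns. In the middle case the column condition
      -- says that `lam / nu` is a horizontal strip.
      rcases lt_trichotomy nu.card d.degree with h3 | h3 | h3
      · rw [coeff_dualGrothendieck_of_card_lt K (by rwa [skewCells_bot]),
          coeff_schur_of_degree_ne K h3.ne']
        simp
      · rw [coeff_schur_of_degree_eq K h3.symm]
        have : numCols lam nu = lam.card - d.degree ↔ numCols lam nu + nu.card = lam.card := by
          omega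
        simp only [this]
      · rw [if_neg (by omega), coeff_schur_of_degree_ne K h3.ne, ite_self]
    · intro k _ hk
      exact coeff_schur_of_degree_ne K (by rw [degree_add_single]; omega)
    · intro h
      exact absurd (Finset.mem_range.2 (by omega)) h

end Branching

/-! ### Spanning sets of the ring of symmetric functions -/

section Span

variable (K : Type*) [CommRing K]

/-- The Schur function as an element of the ring of symmetric functions. -/
def schurFn (lam : YoungDiagram) : SymmFn K := ⟨schur K lam, schur_mem K lam⟩

variable {K}

/-- The inclusion of the symmetric functions into the symmetric power series. -/
def toCompleted (f : SymmFn K) : Completed K := ⟨f, f.2.1⟩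

theorem coe_finset_sum {ι : Type*} (s : Finset ι) (f : ι → SymmFn K) :
    ((∑ i ∈ s, f i : SymmFn K) : MvPowerSeries ℕ K) = ∑ i ∈ s, (f i : MvPowerSeries ℕ K) :=
  map_sum (SymmFn K).val f s

theorem coeff_eq_sum_schurCoeff (f : SymmFn K) (d : ℕ →₀ ℕ) :
    coeff d (f : MvPowerSeries ℕ K) =
      ∑ lam ∈ diagrams d.degree, schurCoeff (toCompleted f) lam * coeff d (schur K lam) := by
  rw [← coeff_schurSum, schurSum_schurCoeff]
  rfl

/-- Since `s_lam` is the top component of `g_lam`, subtracting the `g_lam` with the Schur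
coefficients of the top component of `f` lowers the degree. This gives uniqueness of `I`. -/
theorem span_dualG : Submodule.span K (Set.range fun lam => dualG K lam ⊥ bot_le) = ⊤ := by
  have key : ∀ (m : ℕ) (f : SymmFn K), DegreeLT (f : MvPowerSeries ℕ K) m →
      f ∈ Submodule.span K (Set.range fun lam => dualG K lam ⊥ bot_le) := by
    intro m
    induction m with
    | zero =>
      intro f hf
      have : f = 0 := Subtype.ext (MvPowerSeries.ext fun d => hf d (Nat.zero_le _))
      rw [this]
      exact Submodule.zero_mem _
    | succ m ih =>
      intro f hf
      let g : SymmFn K := ∑ lam ∈ diagrams m, schurCoeff (toCompleted f) lam • dualG K lam ⊥ bot_le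
      have hg : g ∈ Submodule.span K (Set.range fun lam => dualG K lam ⊥ bot_le) :=
        Submodule.sum_mem _ fun lam _ =>
          Submodule.smul_mem _ _ (Submodule.subset_span ⟨lam, rfl⟩)
      have hcoeff : ∀ d, coeff d (g : MvPowerSeries ℕ K) = ∑ lam ∈ diagrams m,
          schurCoeff (toCompleted f) lam * coeff d (dualGrothendieck K lam ⊥) := by
        intro d
        rw [coe_finset_sum, map_sum]
        rfl
      rw [← sub_add_cancel f g]
      refine Submodule.add_mem _ (ih _ fun d hd => ?_) hg
      change coeff d ((f : MvPowerSeries ℕ K) - (g : MvPowerSeries ℕ K)) = 0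
      rw [map_sub, hcoeff]
      rcases hd.eq_or_lt with rfl | hd
      · rw [coeff_eq_sum_schurCoeff, sub_eq_zero]
        refine Finset.sum_congr rfl fun lam hlam => ?_
        rw [coeff_schur_of_degree_eq K (mem_diagrams.1 hlam).symm]
      · rw [hf d hd, zero_sub, neg_eq_zero]
        refine Finset.sum_eq_zero fun lam hlam => ?_
        rw [coeff_dualGrothendieck_of_card_lt K, mul_zero]
        rwa [skewCells_bot, ← YoungDiagram.card, mem_diagrams.1 hlam]
  rw [eq_top_iff]
  intro f _
  obtain ⟨m, hm⟩ := exists_degreeLT f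
  exact key m f hm

theorem span_schurFn : Submodule.span K (Set.range (schurFn K)) = ⊤ := by
  rw [eq_top_iff]
  intro f _
  obtain ⟨m, hm⟩ := exists_degreeLT f
  have h : f = ∑ n ∈ Finset.range m, ∑ lam ∈ diagrams n,
      schurCoeff (toCompleted f) lam • schurFn K lam := by
    refine Subtype.ext (MvPowerSeries.ext fun d => ?_)
    have h1 : ∀ n, coeff d ((∑ lam ∈ diagrams n, schurCoeff (toCompleted f) lam • schurFn K lam :
        SymmFn K) : MvPowerSeries ℕ K) = if d.degree = n then coeff d (f : MvPowerSeries ℕ K)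
          else 0 := by
      intro n
      rw [coe_finset_sum, map_sum]
      split_ifs with h2
      · subst h2
        rw [coeff_eq_sum_schurCoeff]
        rfl
      · refine Finset.sum_eq_zero fun lam hlam => ?_
        change schurCoeff (toCompleted f) lam * coeff d (schur K lam) = 0
        rw [coeff_schur_of_degree_ne K (by rwa [mem_diagrams.1 hlam]), mul_zero]
    rw [coe_finset_sum, map_sum, Finset.sum_congr rfl fun n _ => h1 n, Finset.sum_ite_eq]
    split_ifs with h2
    · rfl
    · exact hm d (by simpa using h2)
  rw [h]
  exact Submodule.sum_mem _ fun n _ => Submodule.sum_mem _ fun lam _ =>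
    Submodule.smul_mem _ _ (Submodule.subset_span ⟨lam, rfl⟩)

end Span

/-! ### Columns and the Schur expansion of `E (-1)` -/

section Columns

variable {K : Type*} [CommRing K]

theorem card_eq_colLen_add (nu : YoungDiagram) :
    nu.card = nu.colLen 0 + (dropCol nu).card := by
  have h1 : (dropCol nu).card = ((dropCol nu).cells.image (fun c => (c.1, c.2 + 1))).card := by
    rw [Finset.card_image_of_injective]
    rintro ⟨a, b⟩ ⟨c, d⟩ h
    simpa using h
  rw [h1, YoungDiagram.colLen_eq_card, YoungDiagram.col, YoungDiagram.card,
    ← Finset.card_filter_add_card_filter_not (s := nu.cells) (fun c => c.2 = 0)]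
  congr 2
  ext ⟨i, j⟩
  rcases j with _ | j
  · simp
  · simp [YoungDiagram.mem_cells]

theorem colLen_bot (j : ℕ) : (⊥ : YoungDiagram).colLen j = 0 :=
  colLen_eq_of_forall (by simp)

theorem card_bot : (⊥ : YoungDiagram).card = 0 := by
  simp [YoungDiagram.card]

theorem eq_of_dropCol_eq_bot {mu nu : YoungDiagram} (hmu : dropCol mu = ⊥) (hnu : dropCol nu = ⊥)
    (h : mu.card = nu.card) : mu = nu := by
  refine eq_of_dropCol_eq (hmu.trans hnu.symm) ?_
  rw [card_eq_colLen_add mu, card_eq_colLen_add nu, hmu, hnu] at h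
  exact Nat.add_right_cancel h

theorem dropCol_eq_bot_iff {nu : YoungDiagram} : dropCol nu = ⊥ ↔ ∀ i, rowVec nu i ≤ 1 := by
  constructor
  · intro h i
    rw [rowVec_apply]
    by_contra! h1
    have h2 : (i, 0) ∈ dropCol nu := mem_dropCol.2 (YoungDiagram.mem_iff_lt_rowLen.2 h1)
    rw [h] at h2
    exact YoungDiagram.notMem_bot _ h2
  · intro h
    refine le_bot_iff.1 ?_
    rintro ⟨i, j⟩ hc
    have h1 := YoungDiagram.mem_iff_lt_rowLen.1 (mem_dropCol.1 hc)
    have h2 := h i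
    rw [rowVec_apply] at h2
    omega

theorem content_le_one {lam : YoungDiagram} (h : dropCol lam = ⊥)
    (T : SemistandardYoungTableau lam) (i : ℕ) : content T i ≤ 1 := by
  rw [← weight_toReversePlanePartition, ReversePlanePartition.weight_apply]
  refine (Finset.card_le_card (t := {0}) ?_).trans (Finset.card_singleton 0).le
  intro j hj
  obtain ⟨⟨a, b⟩, hc, rfl⟩ := Finset.mem_image.1 hj
  have h1 := (mem_skewCells.1 (Finset.mem_filter.1 hc).1).1
  rcases b with _ | b
  · simp
  · rw [← mem_dropCol, h] at h1
    exact absurd h1 (YoungDiagram.notMem_bot _)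

open Classical in
/-- The coefficients of `E (-1)` in the Schur basis. -/
def signCol (K : Type*) [CommRing K] (lam : YoungDiagram) : K :=
  if dropCol lam = ⊥ then (-1) ^ lam.card else 0

open Classical in
theorem coeff_elemSeries (t : K) (d : ℕ →₀ ℕ) :
    coeff d (elemSeries t) = if ∀ k, d k ≤ 1 then t ^ d.degree else 0 := by
  change ∑ᶠ i : ℕ, t ^ i * (if d.degree = i ∧ ∀ k, d k ≤ 1 then (1 : K) else 0) = _
  rw [finsum_eq_single _ d.degree]
  · simp
  · intro i hi
    rw [if_neg (fun h => hi h.1.symm), mul_zero]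

/-- This is `e_i = s_{(1^i)}`, tested at partition exponents: a one-column tableau has squarefree
content, and among squarefree partition exponents there is one of each degree. -/
theorem schurSum_signCol : schurSum (signCol K) = elemSeries (-1) := by
  classical
  refine completed_ext (schurSum_mem _) (elemSeries_mem _) fun mu => ?_
  rw [coeff_schurSum, coeff_elemSeries, degree_rowVec]
  simp only [← dropCol_eq_bot_iff]
  split_ifs with h
  · rw [Finset.sum_eq_single mu]
    · rw [coeff_rowVec_schur_self, signCol, if_pos h, mul_one]
    · intro lam hlam hne
      rw [signCol, if_neg, zero_mul]
      exact fun h1 => hne (eq_of_dropCol_eq_bot h1 h (mem_diagrams.1 hlam))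
    · intro h1
      exact absurd (mem_diagrams.2 rfl) h1
  · refine Finset.sum_eq_zero fun lam _ => ?_
    by_cases h1 : dropCol lam = ⊥
    · have h2 : coeff (rowVec mu) (schur K lam) = 0 := by
        by_contra h3
        obtain ⟨T, hT⟩ := exists_tableau_of_coeff_ne_zero h3
        exact h (dropCol_eq_bot_iff.2 fun i => hT ▸ content_le_one h1 T i)
      rw [h2, mul_zero]
    · rw [signCol, if_neg h1, zero_mul]

theorem schurCoeff_E : schurCoeff (E (-1 : K)) = signCol K :=
  schurCoeff_eq schurSum_signCol

/-! ### The Hall pairing with `E (-1)` -/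

theorem schurSum_add (A B : YoungDiagram → K) :
    schurSum (A + B) = schurSum A + schurSum B := by
  ext d
  rw [map_add, coeff_schurSum, coeff_schurSum, coeff_schurSum, ← Finset.sum_add_distrib]
  exact Finset.sum_congr rfl fun lam _ => add_mul _ _ _

theorem schurSum_smul (r : K) (A : YoungDiagram → K) : schurSum (r • A) = r • schurSum A := by
  ext d
  rw [map_smul, coeff_schurSum, coeff_schurSum, Finset.smul_sum]
  exact Finset.sum_congr rfl fun lam _ => mul_assoc _ _ _

theorem schurCoeff_add (F G : Completed K) : schurCoeff (F + G) = schurCoeff F + schurCoeff G :=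
  schurCoeff_eq (by rw [schurSum_add, schurSum_schurCoeff, schurSum_schurCoeff]; rfl)

theorem schurCoeff_smul (r : K) (F : Completed K) : schurCoeff (r • F) = r • schurCoeff F :=
  schurCoeff_eq (by rw [schurSum_smul, schurSum_schurCoeff]; rfl)

/-- Needed for linearity of `hall`: `finsum` takes the value `0` on infinite supports and is
additive only on finite ones. -/
theorem finite_support_schurCoeff (f : SymmFn K) :
    (Function.support (schurCoeff (toCompleted f))).Finite := by
  classical
  obtain ⟨N, hN⟩ := f.2.2
  refine ((Finset.range (N + 1)).biUnion diagrams).finite_toSet.subset fun lam hlam => ?_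
  rw [Finset.mem_coe, Finset.mem_biUnion]
  refine ⟨lam.card, Finset.mem_range.2 (Nat.lt_succ_iff.2 (le_of_not_gt fun h => ?_)),
    mem_diagrams.2 rfl⟩
  exact hlam (schurCoeff_eq_zero f.2.1 hN h)

/-- The Hall pairing is linear in the second argument. -/
def hallLin (F : Completed K) : SymmFn K →ₗ[K] K where
  toFun := hall F
  map_add' f g := by
    have h : ∀ f : SymmFn K, (Function.support fun lam =>
        schurCoeff F lam * schurCoeff (toCompleted f) lam).Finite := fun f =>
      (finite_support_schurCoeff f).subset fun lam hlam h =>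
        hlam (show _ * schurCoeff (toCompleted f) lam = 0 by rw [h, mul_zero])
    change ∑ᶠ lam, schurCoeff F lam * schurCoeff (toCompleted f + toCompleted g) lam = _
    simp only [schurCoeff_add, Pi.add_apply, mul_add]
    exact finsum_add_distrib (h f) (h g)
  map_smul' r f := by
    change ∑ᶠ lam, schurCoeff F lam * schurCoeff (r • toCompleted f) lam =
      r * ∑ᶠ lam, schurCoeff F lam * schurCoeff (toCompleted f) lam
    rw [mul_finsum']
    · refine finsum_congr fun lam => ?_
      rw [schurCoeff_smul, Pi.smul_apply, smul_eq_mul, mul_left_comm]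
    · exact (finite_support_schurCoeff f).subset fun lam hlam h =>
        hlam (show _ * schurCoeff (toCompleted f) lam = 0 by rw [h, mul_zero])

open Classical in
theorem schurCoeff_schurFn (lam : YoungDiagram) :
    schurCoeff (toCompleted (schurFn K lam)) = Pi.single lam 1 := by
  refine schurCoeff_eq (MvPowerSeries.ext fun d => ?_)
  change _ = coeff d (schur K lam)
  rw [coeff_schurSum]
  by_cases hd : d.degree = lam.card
  · rw [Finset.sum_eq_single lam]
    · rw [Pi.single_eq_same, one_mul]
    · intro nu _ hne
      rw [Pi.single_eq_of_ne hne, zero_mul]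
    · intro h
      exact absurd (mem_diagrams.2 hd.symm) h
  · rw [coeff_schur_of_degree_ne K hd]
    refine Finset.sum_eq_zero fun nu hnu => ?_
    rw [Pi.single_eq_of_ne, zero_mul]
    rintro rfl
    exact hd (mem_diagrams.1 hnu).symm

theorem hallLin_schurFn (lam : YoungDiagram) :
    hallLin (E (-1 : K)) (schurFn K lam) = signCol K lam := by
  classical
  change ∑ᶠ nu, schurCoeff (E (-1 : K)) nu * schurCoeff (toCompleted (schurFn K lam)) nu = _
  rw [schurCoeff_E, schurCoeff_schurFn, finsum_eq_single _ lam]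
  · rw [Pi.single_eq_same, mul_one]
  · intro nu hne
    rw [Pi.single_eq_of_ne hne, mul_zero]

/-- Cancellation over the columns contained in `lam` whose complement is a horizontal strip. -/
theorem sum_signCol (lam : YoungDiagram) :
    ∑ nu ∈ Finset.Icc ⊥ lam with numCols lam nu + nu.card = lam.card, signCol K nu =
      (open Classical in if lam = ⊥ then 1 else 0) := by
  classical
  -- Removing the column of height `i` leaves a horizontal strip exactly when at most one cell of
  -- the first column remains and every later column has at most one cell. The two possible heights
  -- have opposite signs.
  have h1 : ∑ nu ∈ Finset.Icc ⊥ lam with numCols lam nu + nu.card = lam.card, signCol K nu =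
      ∑ i ∈ Finset.range (lam.colLen 0 + 1),
        if (i = lam.colLen 0 ∨ i + 1 = lam.colLen 0) ∧
          numCols (dropCol lam) ⊥ = (dropCol lam).card then (-1) ^ i else 0 := by
    simp only [signCol]
    rw [Finset.sum_filter, ← Finset.sum_filter_add_sum_filter_not _ (fun nu => dropCol nu = ⊥),
      Finset.sum_eq_zero (s := (Finset.Icc ⊥ lam).filter fun nu => ¬ dropCol nu = ⊥), add_zero]
    · refine Finset.sum_bij' (fun nu _ => nu.colLen 0)
        (fun i _ => consCol i ⊥ (by rw [colLen_bot]; exact Nat.zero_le i)) ?_ ?_ ?_ ?_ ?_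
      · intro nu hnu
        have := colLen_mono (Finset.mem_Icc.1 (Finset.mem_filter.1 hnu).1).2 0
        exact Finset.mem_range.2 (by omega)
      · intro i hi
        rw [Finset.mem_range] at hi
        simp only [Finset.mem_filter, Finset.mem_Icc, bot_le, true_and, dropCol_consCol, and_true]
        exact consCol_le_iff.2 ⟨by omega, bot_le⟩
      · intro nu hnu
        exact eq_of_dropCol_eq (dropCol_consCol.trans (Finset.mem_filter.1 hnu).2.symm)
          colLen_consCol
      · intro i hi
        exact colLen_consCol
      · intro nu hnu
        obtain ⟨h2, h3⟩ := Finset.mem_filter.1 hnu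
        have h4 := colLen_mono (Finset.mem_Icc.1 h2).2 0
        have h5 := card_eq_colLen_add nu
        have h6 := card_eq_colLen_add lam
        have h7 := numCols_eq lam nu
        have h8 := numCols_le_card (dropCol lam) ⊥
        rw [skewCells_bot, ← YoungDiagram.card] at h8
        rw [h3] at h7
        rw [h3, card_bot, add_zero] at h5
        rw [if_pos h3, h5]
        congr 1
        refine propext ?_
        rw [h7, h6]
        split_ifs <;> omega
    · intro nu hnu
      rw [if_neg (Finset.mem_filter.1 hnu).2, ite_self]
  rw [h1]
  by_cases hP : numCols (dropCol lam) ⊥ = (dropCol lam).card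
  · simp only [hP, and_true]
    rcases hl : lam.colLen 0 with _ | l
    · have hbot : lam = ⊥ := by
        refine le_bot_iff.1 ?_
        rintro ⟨i, j⟩ hc
        have := YoungDiagram.mem_iff_lt_colLen.1 (lam.up_left_mem le_rfl (Nat.zero_le j) hc)
        omega
      simp [hbot]
    · have hbot : lam ≠ ⊥ := by
        rintro rfl
        rw [colLen_bot] at hl
        omega
      rw [if_neg hbot, Finset.sum_range_succ, Finset.sum_range_succ, Finset.sum_eq_zero]
      · simp [pow_succ]
      · intro i hi
        rw [Finset.mem_range] at hi
        rw [if_neg (by omega)]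
  · have hbot : lam ≠ ⊥ := by
      rintro rfl
      refine hP ?_
      have h2 : dropCol ⊥ = ⊥ := le_bot_iff.1 (by rintro ⟨i, j⟩ hc; simp at hc)
      rw [h2, card_bot]
      exact numCols_eq_zero.2 le_rfl
    simp [hP, hbot]

/-- The constant coefficient of a symmetric function. -/
def constHom (K : Type*) [CommRing K] : SymmFn K →ₐ[K] K :=
  AlgHom.ofLinearMap ((MvPowerSeries.coeff (R := K) (0 : ℕ →₀ ℕ)).comp (SymmFn K).val.toLinearMap)
    (by simp) (fun f g => by simp)

theorem constHom_apply (f : SymmFn K) : constHom K f = coeff 0 (f : MvPowerSeries ℕ K) := rfl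

/-- By linearity it suffices to treat Schur functions, where the branching rule turns the left side
into the sum of `sum_signCol`. -/
theorem hallLin_plusOne (f : SymmFn K) : hallLin (E (-1 : K)) (plusOneEquiv f) = constHom K f := by
  classical
  have h : (hallLin (E (-1 : K))).comp (plusOneEquiv (K := K)).toLinearMap =
      (constHom K).toLinearMap := by
    refine LinearMap.ext_on span_schurFn ?_
    rintro _ ⟨lam, rfl⟩
    have h1 : plusOneEquiv (schurFn K lam) =
        ∑ nu ∈ Finset.Icc ⊥ lam with numCols lam nu + nu.card = lam.card, schurFn K nu :=
      Subtype.ext (by rw [coe_finset_sum]; exact plusOne_schur K lam)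
    change hallLin (E (-1 : K)) (plusOneEquiv (schurFn K lam)) = coeff 0 (schur K lam)
    rw [h1, map_sum, Finset.sum_congr rfl fun nu _ => hallLin_schurFn nu, sum_signCol]
    split_ifs with hl
    · subst hl
      have h2 : rowVec ⊥ = 0 := by simp [rowVec]
      rw [← h2, coeff_rowVec_schur_self]
    · rw [coeff_schur_of_degree_ne]
      intro h2
      refine hl (YoungDiagram.ext ?_)
      simpa using h2.symm
  exact LinearMap.congr_fun h f

theorem hall_eq (f : SymmFn K) : hall (E (-1 : K)) f = constHom K (plusOneEquiv.symm f) := by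
  rw [← hallLin_plusOne, AlgEquiv.apply_symm_apply]
  rfl

end Columns

/-! ### The Möbius function of Young's lattice -/

section Mobius

open Classical in
/-- The removable corners of `lam` outside `kap`. -/
def cornersOutside (lam kap : YoungDiagram) : Finset (ℕ × ℕ) :=
  (skewCells lam kap).filter fun c => (c.1 + 1, c.2) ∉ lam ∧ (c.1, c.2 + 1) ∉ lam

theorem cornersOutside_nonempty {lam kap : YoungDiagram} (h : kap ≤ lam) (hne : kap ≠ lam) :
    (cornersOutside lam kap).Nonempty := by
  classical
  have h1 : (skewCells lam kap).Nonempty := by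
    rw [Finset.nonempty_iff_ne_empty]
    intro h2
    refine hne (le_antisymm h fun c hc => ?_)
    by_contra h3
    have : c ∈ skewCells lam kap := mem_skewCells.2 ⟨hc, h3⟩
    rw [h2] at this
    exact Finset.notMem_empty _ this
  obtain ⟨⟨i, j⟩, hc, hmax⟩ := Finset.exists_max_image _ (fun c : ℕ × ℕ => c.1 + c.2) h1
  rw [mem_skewCells] at hc
  refine ⟨(i, j), Finset.mem_filter.2 ⟨mem_skewCells.2 hc, fun h2 => ?_, fun h2 => ?_⟩⟩
  · have := hmax (i + 1, j) (mem_skewCells.2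
      ⟨h2, fun h3 => hc.2 (kap.up_left_mem (Nat.le_succ i) le_rfl h3)⟩)
    simp only at this
    omega
  · have := hmax (i, j + 1) (mem_skewCells.2
      ⟨h2, fun h3 => hc.2 (kap.up_left_mem le_rfl (Nat.le_succ j) h3)⟩)
    simp only at this
    omega

/-- Removing a set of removable corners from a Young diagram. -/
def removeCorners (lam : YoungDiagram) (s : Finset (ℕ × ℕ))
    (hs : ∀ c ∈ s, (c.1 + 1, c.2) ∉ lam ∧ (c.1, c.2 + 1) ∉ lam) : YoungDiagram where
  cells := lam.cells \ s
  isLowerSet := by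
    rintro ⟨i, j⟩ ⟨i', j'⟩ hle hc
    obtain ⟨h1, h2⟩ : i' ≤ i ∧ j' ≤ j := hle
    simp only [Finset.coe_sdiff, Set.mem_sdiff, Finset.mem_coe, YoungDiagram.mem_cells] at hc ⊢
    refine ⟨lam.up_left_mem h1 h2 hc.1, fun h3 => ?_⟩
    obtain ⟨h4, h5⟩ := hs _ h3
    rcases h1.eq_or_lt with rfl | h1
    · rcases h2.eq_or_lt with rfl | h2
      · exact hc.2 h3
      · exact h5 (lam.up_left_mem le_rfl h2 hc.1)
    · exact h4 (lam.up_left_mem h1 h2 hc.1)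

/-- The diagrams `nu` with `lam / nu` a rook strip correspond to sets of removable corners of `lam`
outside `kap`. The alternating sum over all subsets vanishes unless there is no such corner, that
is, unless `kap = lam`. -/
theorem sum_rookStrip (lam kap : YoungDiagram) (h : kap ≤ lam) :
    ∑ nu ∈ Finset.Icc kap lam, (open Classical in
      if IsRookStrip lam nu then (-1 : ℤ) ^ (skewCells lam nu).card else 0) =
      (open Classical in if kap = lam then 1 else 0) := by
  classical
  have h1 : ∑ nu ∈ Finset.Icc kap lam with IsRookStrip lam nu,
      (-1 : ℤ) ^ (skewCells lam nu).card =
      ∑ s ∈ (cornersOutside lam kap).powerset, (-1 : ℤ) ^ s.card := by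
    have hs : ∀ s ∈ (cornersOutside lam kap).powerset,
        ∀ c ∈ s, (c.1 + 1, c.2) ∉ lam ∧ (c.1, c.2 + 1) ∉ lam := fun s hs c hc =>
      (Finset.mem_filter.1 (Finset.mem_powerset.1 hs hc)).2
    have hsk : ∀ s ∈ (cornersOutside lam kap).powerset, s ⊆ skewCells lam kap := fun s hs =>
      (Finset.mem_powerset.1 hs).trans (Finset.filter_subset _ _)
    have hcell : ∀ s (h : s ∈ (cornersOutside lam kap).powerset),
        skewCells lam (removeCorners lam s (hs s h)) = s := fun s h =>
      Finset.sdiff_sdiff_eq_self ((hsk s h).trans Finset.sdiff_subset)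
    refine Finset.sum_bij' (fun nu _ => skewCells lam nu)
      (fun s h => removeCorners lam s (hs s h)) ?_ ?_ ?_ ?_ ?_
    · intro nu hnu
      simp only [Finset.mem_filter, Finset.mem_Icc] at hnu
      refine Finset.mem_powerset.2 fun c hc => Finset.mem_filter.2 ⟨?_, hnu.2 c hc⟩
      rw [mem_skewCells] at hc ⊢
      exact ⟨hc.1, fun h2 => hc.2 (hnu.1.1 h2)⟩
    · intro s h'
      refine Finset.mem_filter.2 ⟨Finset.mem_Icc.2 ⟨fun c hc => ?_, fun c hc => ?_⟩, ?_⟩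
      · exact Finset.mem_sdiff.2 ⟨h hc, fun h2 => (mem_skewCells.1 (hsk s h' h2)).2 hc⟩
      · exact (Finset.mem_sdiff.1 hc).1
      · rw [IsRookStrip, hcell s h']
        exact hs s h'
    · intro nu hnu
      simp only [Finset.mem_filter, Finset.mem_Icc] at hnu
      exact YoungDiagram.ext
        (Finset.sdiff_sdiff_eq_self (YoungDiagram.cells_subset_iff.2 hnu.1.2))
    · exact hcell
    · intro nu _
      rfl
  rw [← Finset.sum_filter, h1, Finset.sum_powerset_neg_one_pow_card]
  congr 1
  refine propext ⟨fun h2 => ?_, ?_⟩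
  · by_contra h3
    exact (cornersOutside_nonempty h h3).ne_empty h2
  · rintro rfl
    simp [cornersOutside, skewCells]

-- By `sum_rookStrip` the right side satisfies the recursion that determines the Möbius function,
-- with the upper end `lam` fixed.
open Classical in
theorem mu_eq (lam : YoungDiagram) : ∀ mu : YoungDiagram, mu ≤ lam →
    IncidenceAlgebra.mu ℤ mu lam =
      if IsRookStrip lam mu then (-1) ^ (skewCells lam mu).card else 0 := by
  have key : ∀ (n : ℕ) (mu : YoungDiagram), mu ≤ lam → (skewCells lam mu).card = n →
      IncidenceAlgebra.mu ℤ mu lam =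
        if IsRookStrip lam mu then (-1) ^ (skewCells lam mu).card else 0 := by
    intro n
    induction n using Nat.strong_induction_on with
    | _ n ih =>
      rintro mu h rfl
      have h1 := IncidenceAlgebra.sum_Icc_mu_left (𝕜 := ℤ) mu lam
      rw [← sum_rookStrip lam mu h, ← Finset.add_sum_erase _ _ (Finset.left_mem_Icc.2 h),
        ← Finset.add_sum_erase (Finset.Icc mu lam) (fun nu => ite (IsRookStrip lam nu) _ _)
          (Finset.left_mem_Icc.2 h)] at h1
      rw [Finset.sum_congr rfl (g := fun nu =>
        if IsRookStrip lam nu then (-1 : ℤ) ^ (skewCells lam nu).card else 0)] at h1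
      · exact add_right_cancel h1
      · intro nu hnu
        rw [Finset.mem_erase, Finset.mem_Icc] at hnu
        refine ih _ (Finset.card_lt_card ?_) nu hnu.2.2 rfl
        have hlt : mu < nu := lt_of_le_of_ne hnu.2.1 hnu.1.symm
        refine ⟨Finset.sdiff_subset_sdiff le_rfl (YoungDiagram.cells_subset_iff.2 hlt.le), ?_⟩
        intro hsub
        refine hlt.not_ge fun c hc => ?_
        by_contra h3
        exact (mem_skewCells.1 (hsub (mem_skewCells.2 ⟨hnu.2.2 hc, h3⟩))).2 hc
  exact fun mu h => key _ mu h rfl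

end Mobius

/-! ### The inverse of the automorphism -/

section Inverse

variable (K : Type*) [CommRing K]

open Classical in
/-- The dual stable Grothendieck polynomial as a symmetric function, zero unless `mu ≤ lam`. -/
def skewG (lam mu : YoungDiagram) : SymmFn K := if h : mu ≤ lam then dualG K lam mu h else 0

variable {K}

theorem skewG_of_le {lam mu : YoungDiagram} (h : mu ≤ lam) : skewG K lam mu = dualG K lam mu h :=
  dif_pos h

theorem coe_skewG {lam mu : YoungDiagram} (h : mu ≤ lam) :
    (skewG K lam mu : MvPowerSeries ℕ K) = dualGrothendieck K lam mu := by
  rw [skewG_of_le h]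
  rfl

theorem plusOneEquiv_skewG_right {lam mu : YoungDiagram} (h : mu ≤ lam) :
    plusOneEquiv (skewG K lam mu) = ∑ nu ∈ Finset.Icc mu lam, skewG K nu mu := by
  refine Subtype.ext ?_
  rw [coe_plusOneEquiv, coe_skewG h, plusOne_dualGrothendieck_right K h, coe_finset_sum]
  exact Finset.sum_congr rfl fun nu hnu => (coe_skewG (Finset.mem_Icc.1 hnu).1).symm

theorem plusOneEquiv_skewG_left {lam mu : YoungDiagram} (h : mu ≤ lam) :
    plusOneEquiv (skewG K lam mu) = ∑ nu ∈ Finset.Icc mu lam, skewG K lam nu := by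
  refine Subtype.ext ?_
  rw [coe_plusOneEquiv, coe_skewG h, plusOne_dualGrothendieck_left K h, coe_finset_sum]
  exact Finset.sum_congr rfl fun nu hnu => (coe_skewG (Finset.mem_Icc.1 hnu).2).symm

-- Möbius inversion in the outer shape: after applying the automorphism and exchanging sums, the
-- coefficient of each `skewG K kap mu` is a full Möbius sum over `[kap, lam]`, which vanishes
-- unless `kap = lam`.
open Classical in
theorem plusOneEquiv_symm_right {lam mu : YoungDiagram} (h : mu ≤ lam) :
    plusOneEquiv.symm (skewG K lam mu) =
      ∑ nu ∈ Finset.Icc mu lam, (IncidenceAlgebra.mu ℤ nu lam : K) • skewG K nu mu := by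
  rw [AlgEquiv.symm_apply_eq, map_sum]
  have h1 : ∀ nu ∈ Finset.Icc mu lam,
      plusOneEquiv ((IncidenceAlgebra.mu ℤ nu lam : K) • skewG K nu mu) =
        ∑ kap ∈ Finset.Icc mu nu, (IncidenceAlgebra.mu ℤ nu lam : K) • skewG K kap mu := by
    intro nu hnu
    rw [map_smul, plusOneEquiv_skewG_right (Finset.mem_Icc.1 hnu).1, Finset.smul_sum]
  rw [Finset.sum_congr rfl h1, Finset.sum_comm' (t' := Finset.Icc mu lam)
    (s' := fun kap => Finset.Icc kap lam)]
  · simp_rw [← Finset.sum_smul, ← Int.cast_sum, IncidenceAlgebra.sum_Icc_mu_left, Int.cast_ite,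
      Int.cast_one, Int.cast_zero, ite_smul, one_smul, zero_smul]
    rw [Finset.sum_ite_eq', if_pos (Finset.right_mem_Icc.2 h)]
  · intro nu kap
    simp only [Finset.mem_Icc]
    exact ⟨fun h => ⟨⟨h.2.2, h.1.2⟩, h.2.1, h.2.2.trans h.1.2⟩,
      fun h => ⟨⟨h.2.1.trans h.1.1, h.1.2⟩, h.2.1, h.1.1⟩⟩

-- The dual inversion, in the inner shape: here the Möbius sums run over `[mu, kap]`.
open Classical in
theorem plusOneEquiv_symm_left {lam mu : YoungDiagram} (h : mu ≤ lam) :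
    plusOneEquiv.symm (skewG K lam mu) =
      ∑ nu ∈ Finset.Icc mu lam, (IncidenceAlgebra.mu ℤ mu nu : K) • skewG K lam nu := by
  rw [AlgEquiv.symm_apply_eq, map_sum]
  have h1 : ∀ nu ∈ Finset.Icc mu lam,
      plusOneEquiv ((IncidenceAlgebra.mu ℤ mu nu : K) • skewG K lam nu) =
        ∑ kap ∈ Finset.Icc nu lam, (IncidenceAlgebra.mu ℤ mu nu : K) • skewG K lam kap := by
    intro nu hnu
    rw [map_smul, plusOneEquiv_skewG_left (Finset.mem_Icc.1 hnu).2, Finset.smul_sum]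
  rw [Finset.sum_congr rfl h1, Finset.sum_comm' (t' := Finset.Icc mu lam)
    (s' := fun kap => Finset.Icc mu kap)]
  · simp_rw [← Finset.sum_smul, ← Int.cast_sum, IncidenceAlgebra.sum_Icc_mu_right, Int.cast_ite,
      Int.cast_one, Int.cast_zero, ite_smul, one_smul, zero_smul]
    rw [Finset.sum_ite_eq, if_pos (Finset.left_mem_Icc.2 h)]
  · intro nu kap
    simp only [Finset.mem_Icc]
    exact ⟨fun h => ⟨⟨h.1.1, h.2.1⟩, h.1.1.trans h.2.1, h.2.2⟩,
      fun h => ⟨⟨h.1.1, h.1.2.trans h.2.2⟩, h.1.2, h.2.2⟩⟩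

open Classical in
theorem constHom_skewG {lam mu : YoungDiagram} (h : mu ≤ lam) :
    constHom K (skewG K lam mu) = if mu = lam then 1 else 0 := by
  rw [constHom_apply, coe_skewG h, coeff_dualGrothendieck K h, colProd_zero,
    IncidenceAlgebra.one_apply]

-- In the inversion formula only `nu = mu` has a nonzero constant term, and its coefficient is the
-- Möbius number.
open Classical in
theorem hall_skewG {lam mu : YoungDiagram} (h : mu ≤ lam) :
    hall (E (-1 : K)) (skewG K lam mu) = (IncidenceAlgebra.mu ℤ mu lam : K) := by
  rw [hall_eq, plusOneEquiv_symm_right h, map_sum, Finset.sum_eq_single mu]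
  · rw [map_smul, constHom_skewG le_rfl, if_pos rfl, smul_eq_mul, mul_one]
  · intro nu hnu hne
    rw [map_smul, constHom_skewG (Finset.mem_Icc.1 hnu).1, if_neg hne.symm, smul_zero]
  · intro h1
    exact absurd (Finset.left_mem_Icc.2 h) h1

open Classical in
theorem mu_smul_skewG {lam mu nu kap : YoungDiagram} (h : mu ≤ lam) (h' : kap ≤ nu) :
    (((IncidenceAlgebra.mu ℤ mu lam : K) • skewG K nu kap : SymmFn K) : MvPowerSeries ℕ K) =
      if IsRookStrip lam mu then (-1) ^ (skewCells lam mu).card * dualGrothendieck K nu kap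
        else 0 := by
  rw [mu_eq lam mu h]
  change _ • (skewG K nu kap : MvPowerSeries ℕ K) = _
  rw [coe_skewG h']
  split_ifs
  · rw [MvPowerSeries.smul_eq_C_mul]
    simp
  · simp

/-- A nonempty diagram contains `(0, 0)`, and this cell is a removable corner only if it is the only
one. -/
theorem isRookStrip_bot_iff (lam : YoungDiagram) : IsRookStrip lam ⊥ ↔ lam.card ≤ 1 := by
  rw [IsRookStrip, skewCells_bot]
  constructor
  · intro h
    refine (Finset.card_le_card (t := {(0, 0)}) ?_).trans (Finset.card_singleton _).le
    rintro ⟨i, j⟩ hc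
    have h0 : (0, 0) ∈ lam := lam.up_left_mem (Nat.zero_le i) (Nat.zero_le j) hc
    rcases i with _ | i
    · rcases j with _ | j
      · exact Finset.mem_singleton_self _
      · exact absurd (lam.up_left_mem le_rfl (by omega) hc) (h _ h0).2
    · exact absurd (lam.up_left_mem (by omega) (Nat.zero_le j) hc) (h _ h0).1
  · intro h c hc
    have h1 := Finset.card_le_one.1 h
    refine ⟨fun h2 => ?_, fun h2 => ?_⟩
    · exact absurd (congrArg Prod.fst (h1 c hc _ h2)) (Nat.succ_ne_self _).symm
    · exact absurd (congrArg Prod.snd (h1 c hc _ h2)) (Nat.succ_ne_self _).symm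

end Inverse

end SymFun

end

/-! ### The main theorem -/

open SymFun Classical in
theorem mainTheorem10 (K : Type*) [CommRing K] :
    ∃ hg : ∀ lam mu : YoungDiagram, mu ≤ lam → dualGrothendieck K lam mu ∈ SymmFn K,
      -- the pairing with `E(-1)` is a ring homomorphism
      (∃ φ : SymmFn K →ₐ[K] K, ∀ f : SymmFn K, φ f = hall (E (-1)) f) ∧
      -- its values on skew dual stable Grothendieck polynomials
      (∀ (lam mu : YoungDiagram) (h : mu ≤ lam),
        hall (E (-1 : K)) ⟨dualGrothendieck K lam mu, hg lam mu h⟩ =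
          if IsRookStrip lam mu then (-1) ^ (skewCells lam mu).card else 0) ∧
      -- in particular, its values on straight shapes
      (∀ lam : YoungDiagram,
        hall (E (-1 : K)) ⟨dualGrothendieck K lam ⊥, hg lam ⊥ bot_le⟩ =
          if lam.card = 0 then 1 else if lam.card = 1 then -1 else 0) ∧
      -- these values are those of the Möbius function of Young's lattice
      (∀ (lam mu : YoungDiagram) (h : mu ≤ lam),
        IncidenceAlgebra.mu ℤ mu lam =
            (if IsRookStrip lam mu then (-1) ^ (skewCells lam mu).card else 0) ∧
          hall (E (-1 : K)) ⟨dualGrothendieck K lam mu, hg lam mu h⟩ =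
            (IncidenceAlgebra.mu ℤ mu lam : K)) ∧
      -- the linear map `I` with `I(g_lam) = ∑ g_mu` exists, is unique and is a ring automorphism,
      -- and its inverse is a signed sum over rook strips
      (∃ I : SymmFn K ≃ₐ[K] SymmFn K,
        (∀ L : SymmFn K →ₗ[K] SymmFn K,
          (∀ lam : YoungDiagram,
            (L ⟨dualGrothendieck K lam ⊥, hg lam ⊥ bot_le⟩ : MvPowerSeries ℕ K) =
              ∑ mu ∈ Finset.Icc ⊥ lam, dualGrothendieck K mu ⊥) ↔ L = I.toLinearMap) ∧
        ∀ (lam mu : YoungDiagram) (h : mu ≤ lam),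
          (I.symm ⟨dualGrothendieck K lam mu, hg lam mu h⟩ : MvPowerSeries ℕ K) =
              ∑ nu ∈ Finset.Icc mu lam with IsRookStrip lam nu,
                (-1) ^ (skewCells lam nu).card * dualGrothendieck K nu mu ∧
          (I.symm ⟨dualGrothendieck K lam mu, hg lam mu h⟩ : MvPowerSeries ℕ K) =
              ∑ nu ∈ Finset.Icc mu lam with IsRookStrip nu mu,
                (-1) ^ (skewCells nu mu).card * dualGrothendieck K lam nu) := by
  have hint : ∀ lam mu : YoungDiagram, mu ≤ lam → (IncidenceAlgebra.mu ℤ mu lam : K) =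
      if IsRookStrip lam mu then (-1) ^ (skewCells lam mu).card else 0 := by
    intro lam mu h
    rw [mu_eq lam mu h]
    split_ifs <;> simp
  have hhall : ∀ (lam mu : YoungDiagram) (h : mu ≤ lam),
      hall (E (-1 : K)) (dualG K lam mu h) = (IncidenceAlgebra.mu ℤ mu lam : K) := by
    intro lam mu h
    rw [← skewG_of_le h, hall_skewG h]
  refine ⟨dualGrothendieck_mem K, ⟨(constHom K).comp plusOneEquiv.symm.toAlgHom,
    fun f => (hall_eq f).symm⟩, fun lam mu h => (hhall lam mu h).trans (hint lam mu h),
    fun lam => ?_, fun lam mu h => ⟨mu_eq lam mu h, hhall lam mu h⟩,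
    plusOneEquiv, fun L => ?_, fun lam mu h => ⟨?_, ?_⟩⟩
  · refine (hhall lam ⊥ bot_le).trans ((hint lam ⊥ bot_le).trans ?_)
    simp only [isRookStrip_bot_iff, skewCells_bot]
    change (if lam.card ≤ 1 then (-1 : K) ^ lam.card else 0) = _
    rcases hc : lam.card with _ | _ | n <;> simp
  · constructor
    · intro hL
      refine LinearMap.ext_on span_dualG ?_
      rintro _ ⟨lam, rfl⟩
      exact Subtype.ext ((hL lam).trans (plusOne_dualGrothendieck_right K bot_le).symm)
    · rintro rfl lam
      exact plusOne_dualGrothendieck_right K bot_le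
  · change (plusOneEquiv.symm (dualG K lam mu h) : MvPowerSeries ℕ K) = _
    rw [← skewG_of_le h, plusOneEquiv_symm_right h, coe_finset_sum, Finset.sum_filter]
    refine Finset.sum_congr rfl fun nu hnu => ?_
    rw [Finset.mem_Icc] at hnu
    exact mu_smul_skewG hnu.2 hnu.1
  · change (plusOneEquiv.symm (dualG K lam mu h) : MvPowerSeries ℕ K) = _
    rw [← skewG_of_le h, plusOneEquiv_symm_left h, coe_finset_sum, Finset.sum_filter]
    refine Finset.sum_congr rfl fun nu hnu => ?_
    rw [Finset.mem_Icc] at hnu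
    exact mu_smul_skewG hnu.1 hnu.2
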